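/- Let $F$ be a field of odd characteristic $p$, let $G$ be a group, and let $\sigma : G \to \{\pm 1\}$ be a nontrivial homomorphism (an orientation of $G$). Equip the group algebra $FG$ with the oriented classical involution $\left(\sum_{g} \alpha_g g\right)^{*} = \sum_{g} \alpha_g \sigma(g) g^{-1}$, and let $(FG)^+ = \{\alpha \in FG : \alpha^* = \alpha\}$ and let $\mathcal{U}^+(FG)$ be the set of units of $FG$ that lie in $(FG)^+$. For a nonempty subset $S$ of a ring put $\gamma^1(S) = S$ and let $\gamma^{n+1}(S)$ be the additive subgroup generated by all $xy - yx$ with $x \in \gamma^n(S)$, $y \in S$; $S$ is Lie nilpotent if $\gamma^n(S) = 0$ for some $n \ge 1$, and the least such $n$ is its Lie nilpotency index $t(S)$. For a nonempty subset $H$ of a group put $\gamma_1(H) = H$ and let $\gamma_{n+1}(H)$ be the subgroup generated by all $x^{-1}y^{-1}xy$ with $x \in \gamma_n(H)$, $y \in H$; $H$ is nilpotent if $\gamma_n(H) = 1$ for some $n \ge 1$, and its nilpotency class $\mathrm{cl}(H)$ is the least $n \ge 0$ with $\gamma_{n+1}(H) = 1$. Assume that $FG$ is Lie nilpotent, and let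 $G'$ be the commutator subgroup of $G$. Then $t((FG)^+) = |G'| + 1$ if and only if $G'$ is cyclic. Moreover, if $G$ is a torsion group, then $\mathrm{cl}(\mathcal{U}^+(FG)) = |G'|$ if and only if $G'$ is cyclic. -/

import Mathlib

namespace OrientedGroupAlgebra

/-- The additive subgroup `[X, Y]` generated by all Lie commutators `x y - y x` with `x ∈ X`,
`y ∈ Y`, for subsets `X`, `Y` of a ring. -/
def lieCommutator {R : Type*} [Ring R] (X Y : Set R) : AddSubgroup R :=
  AddSubgroup.closure {z | ∃ x ∈ X, ∃ y ∈ Y, z = x * y - y * x}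

/-- The lower Lie central series of a subset `S` of a ring, `γ¹(S) = S`,
`γⁿ⁺¹(S) = [γⁿ(S), S]`. The index is shifted by one: `lieLowerSeries S k` is `γᵏ⁺¹(S)`. -/
def lieLowerSeries {R : Type*} [Ring R] (S : Set R) : ℕ → Set R
  | 0 => S
  | k + 1 => (lieCommutator (lieLowerSeries S k) S : Set R)

/-- A subset `S` of a ring is Lie nilpotent if `γⁿ(S) = 0` for some `n ≥ 1`. -/
def IsLieNilpotent {R : Type*} [Ring R] (S : Set R) : Prop :=
  ∃ k : ℕ, lieLowerSeries S k = {0}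

/-- The Lie nilpotency index `t(S)`: the least `n ≥ 1` with `γⁿ(S) = 0`, and `⊤` if `S` is not
Lie nilpotent. -/
noncomputable def lieNilpotencyIndex {R : Type*} [Ring R] (S : Set R) : ℕ∞ :=
  ⨅ k ∈ {k : ℕ | lieLowerSeries S k = {0}}, ((k + 1 : ℕ) : ℕ∞)

/-- The subgroup `(X, Y)` generated by all commutators `(x, y) = x⁻¹ y⁻¹ x y` with `x ∈ X`,
`y ∈ Y`, for subsets `X`, `Y` of a group. -/
def groupCommutator {U : Type*} [Group U] (X Y : Set U) : Subgroup U :=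
  Subgroup.closure {z | ∃ x ∈ X, ∃ y ∈ Y, z = x⁻¹ * y⁻¹ * x * y}

/-- The lower central series of a subset `H` of a group, `γ₁(H) = H`,
`γₙ₊₁(H) = (γₙ(H), H)`. The index is shifted by one: `groupLowerSeries H n` is `γₙ₊₁(H)`. -/
def groupLowerSeries {U : Type*} [Group U] (H : Set U) : ℕ → Set U
  | 0 => H
  | n + 1 => (groupCommutator (groupLowerSeries H n) H : Set U)

/-- The nilpotency class `cl(H)` of a subset `H` of a group: the least `n ≥ 0` with
`γₙ₊₁(H) = 1`, and `⊤` if `H` is not nilpotent. -/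
noncomputable def nilpotencyClass {U : Type*} [Group U] (H : Set U) : ℕ∞ :=
  ⨅ n ∈ {n : ℕ | groupLowerSeries H n = {1}}, (n : ℕ∞)

/-- The oriented classical involution `(∑ α_g g)^* = ∑ α_g σ(g) g⁻¹` of the group algebra `FG`
attached to an orientation `σ : G → {±1}`. -/
noncomputable def orientedInvolution {F G : Type*} [Field F] [Group G] (σ : G →* ℤˣ)
    (x : MonoidAlgebra F G) : MonoidAlgebra F G :=
  x.coeff.sum fun g a => MonoidAlgebra.single g⁻¹ (a * (((σ g : ℤˣ) : ℤ) : F))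

/-- The set `(FG)⁺` of symmetric elements of `FG` under the oriented classical involution. -/
def symmetricElements (F : Type*) {G : Type*} [Field F] [Group G] (σ : G →* ℤˣ) :
    Set (MonoidAlgebra F G) :=
  {x | orientedInvolution σ x = x}

/-- The set `U⁺(FG)` of symmetric units of `FG` under the oriented classical involution. -/
def symmetricUnits (F : Type*) {G : Type*} [Field F] [Group G] (σ : G →* ℤˣ) :
    Set (MonoidAlgebra F G)ˣ :=
  {u | (u : MonoidAlgebra F G) ∈ symmetricElements F σ}

end OrientedGroupAlgebra

/-! Lie nilpotency of FG makes G' a finite p-group and makes some p-power of every group element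
central. Both symmetric series are bounded by the upper Lie powers of FG, since (x,y) - 1 = x⁻¹y⁻¹[x
- 1, y] turns group commutators into Lie ones. So it suffices that `upperLie` vanishes at index |G'|
always, at |G'| - 1 when G' is not cyclic, and that the symmetric series are nontrivial at |G'| - 1
when G' is cyclic.

Let G' = ⟨c⟩. Conjugation fixes c modulo p-th powers, so c - 1 is central modulo (c - 1)³, each
bracket contributes one factor c - 1 (`CyclicCommutators.upperLie_le`), and (c - 1)^|G'| = 0. For
sharpness, take a, b in the kernel of σ with ⁅a, b⁆ = c, and bracket b + b⁻¹ repeatedly with a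
symmetric lift of (a - a⁻¹)(b - b⁻¹). Step k gives (c - 1)ᵏw. Let α(g) be the exponent of ⁅a, g⁆
modulo p. The functional g ↦ α(g)² takes the value 2(-8)ᵏ ≠ 0 on w but kills the annihilator of (c -
1)^(|G'|-1). The same computation works for units close to 1; torsion lets b be a p-element, which
makes the chosen elements units.

If G' is not cyclic, factor out a central subgroup ⟨c⟩ ≤ G' of order p and induct on |G'|. When the
quotient has cyclic commutator subgroup of order r, a lift d of its generator still has dʳ = 1, and
r - 1 brackets past the first already yield a central factor c - 1 (`upperLie_prime_pow_le`). As (c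
- 1)^p = 0, the series stops early. -/

namespace OrientedGroupAlgebra

/-! ### Upper Lie powers of a ring. -/

section UpperLie

variable {R : Type*} [Ring R]

/-- The upper Lie powers of a ring, as left ideals; `upperLie R k` is the power of index `k + 1`. -/
def upperLie (R : Type*) [Ring R] : ℕ → Ideal R
  | 0 => ⊤
  | k + 1 => Ideal.span {z | ∃ x ∈ upperLie R k, ∃ y, z = x * y - y * x}

theorem commutator_mem_upperLie {k : ℕ} {x : R} (hx : x ∈ upperLie R k) (y : R) :
    x * y - y * x ∈ upperLie R (k + 1) :=
  Ideal.subset_span ⟨x, hx, y, rfl⟩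

/-- The left ideals are two-sided because [u, y]r = [u, yr] - y[u, r]. -/
theorem mul_mem_upperLie {k : ℕ} {x : R} (hx : x ∈ upperLie R k) (r : R) :
    x * r ∈ upperLie R k := by
  cases k with
  | zero => trivial
  | succ k =>
    induction hx using Submodule.span_induction with
    | mem z hz =>
      obtain ⟨u, hu, y, rfl⟩ := hz
      have h : (u * y - y * u) * r = (u * (y * r) - y * r * u) - y * (u * r - r * u) := by
        noncomm_ring
      rw [h]
      exact sub_mem (commutator_mem_upperLie hu _)
        (Ideal.mul_mem_left _ _ (commutator_mem_upperLie hu _))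
    | zero => simp
    | add a b _ _ ha hb => rw [add_mul]; exact add_mem ha hb
    | smul a b _ hb =>
      rw [smul_eq_mul, mul_assoc]
      exact Ideal.mul_mem_left _ _ hb

/-- To bound an upper Lie power it suffices to bound Lie commutators by an additive subgroup that
absorbs left multiplication. -/
theorem upperLie_succ_induction {k : ℕ} {P : R → Prop}
    (comm : ∀ x ∈ upperLie R k, ∀ y, P (x * y - y * x)) (zero : P 0)
    (add : ∀ x y, P x → P y → P (x + y)) (mul : ∀ r x, P x → P (r * x)) :
    ∀ x ∈ upperLie R (k + 1), P x := by
  intro x hx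
  induction hx using Submodule.span_induction with
  | mem z hz =>
    obtain ⟨u, hu, y, rfl⟩ := hz
    exact comm u hu y
  | zero => exact zero
  | add a b _ _ ha hb => exact add a b ha hb
  | smul a b _ hb => exact mul a b hb

theorem upperLie_antitone : Antitone (upperLie R) := by
  apply antitone_nat_of_succ_le
  intro k
  exact upperLie_succ_induction (P := (· ∈ upperLie R k))
    (fun x hx y => sub_mem (mul_mem_upperLie hx y) (Ideal.mul_mem_left _ _ hx))
    (zero_mem _) (fun _ _ => add_mem) (fun r _ hx => Ideal.mul_mem_left _ r hx)

theorem lieLowerSeries_subset_upperLie (S : Set R) (k : ℕ) :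
    lieLowerSeries S k ⊆ (upperLie R k : Set R) := by
  induction k with
  | zero => intro x _; trivial
  | succ k ih =>
    change lieCommutator _ _ ≤ (upperLie R (k + 1)).toAddSubgroup
    rw [lieCommutator, AddSubgroup.closure_le]
    rintro _ ⟨x, hx, y, -, rfl⟩
    exact commutator_mem_upperLie (ih hx) y

theorem groupLowerSeries_sub_one_mem_upperLie (H : Set Rˣ) (k : ℕ) :
    ∀ u ∈ groupLowerSeries H k, (u : R) - 1 ∈ upperLie R k := by
  induction k with
  | zero => intro _ _; trivial
  | succ k ih =>
    intro u hu
    change u ∈ groupCommutator _ _ at hu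
    induction hu using Subgroup.closure_induction with
    | mem z hz =>
      obtain ⟨x, hx, y, -, rfl⟩ := hz
      have h : ((x⁻¹ * y⁻¹ * x * y : Rˣ) : R) - 1 =
          (((x⁻¹ * y⁻¹ : Rˣ)) : R) * (((x : R) - 1) * y - y * ((x : R) - 1)) := by
        have h1 : (((x⁻¹ * y⁻¹ : Rˣ)) : R) * (y * x) = 1 := by
          rw [← Units.val_mul, ← Units.val_mul, Units.val_eq_one]; group
        have h2 : ((x : R) - 1) * y - y * ((x : R) - 1) = x * y - y * x := by noncomm_ring
        rw [h2, mul_sub, h1]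
        simp only [Units.val_mul, mul_assoc]
      rw [h]
      exact Ideal.mul_mem_left _ _ (commutator_mem_upperLie (ih x hx) _)
    | one => simp
    | mul a b _ _ ha hb =>
      have h : ((a * b : Rˣ) : R) - 1 = a * ((b : R) - 1) + ((a : R) - 1) := by
        rw [Units.val_mul]; noncomm_ring
      rw [h]
      exact add_mem (Ideal.mul_mem_left _ _ hb) ha
    | inv a _ ha =>
      have h : ((a⁻¹ : Rˣ) : R) - 1 = -((a⁻¹ : Rˣ) : R) * ((a : R) - 1) := by
        rw [mul_sub, neg_mul, Units.inv_mul]; noncomm_ring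
      rw [h]
      exact Ideal.mul_mem_left _ _ ha

theorem map_mem_upperLie {T : Type*} [Ring T] (f : R →+* T) (k : ℕ) :
    ∀ x ∈ upperLie R k, f x ∈ upperLie T k := by
  induction k with
  | zero => intro _ _; trivial
  | succ k ih =>
    refine upperLie_succ_induction (fun x hx y => ?_) (by simp) (fun x y hx hy => ?_)
      (fun r x hx => ?_)
    · rw [map_sub, map_mul, map_mul]
      exact commutator_mem_upperLie (ih x hx) _
    · rw [map_add]; exact add_mem hx hy
    · rw [map_mul]; exact Ideal.mul_mem_left _ _ hx

/-- A central factor passes through brackets and multiplications, so a divisibility at one index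
propagates to all later ones. -/
theorem upperLie_shift {e : R} (he : ∀ x, e * x = x * e) {a b : ℕ}
    (h : ∀ x ∈ upperLie R a, ∃ y ∈ upperLie R b, x = e * y) (j : ℕ) :
    ∀ x ∈ upperLie R (a + j), ∃ y ∈ upperLie R (b + j), x = e * y := by
  induction j with
  | zero => exact h
  | succ j ih =>
    refine upperLie_succ_induction (fun x hx y => ?_) ⟨0, zero_mem _, by simp⟩ ?_ ?_
    · obtain ⟨z, hz, rfl⟩ := ih x hx
      refine ⟨z * y - y * z, commutator_mem_upperLie hz y, ?_⟩
      rw [mul_sub, ← mul_assoc, ← mul_assoc, ← mul_assoc, he y]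
    · rintro _ _ ⟨x, hx, rfl⟩ ⟨y, hy, rfl⟩
      exact ⟨x + y, add_mem hx hy, (mul_add _ _ _).symm⟩
    · rintro r _ ⟨x, hx, rfl⟩
      exact ⟨r * x, Ideal.mul_mem_left _ _ hx, by rw [← mul_assoc, ← mul_assoc, he r]⟩

theorem upperLie_shift_pow {e : R} (he : ∀ x, e * x = x * e) {b d : ℕ}
    (h : ∀ x ∈ upperLie R (b + d), ∃ y ∈ upperLie R b, x = e * y) (k : ℕ) :
    ∀ x ∈ upperLie R (b + k * d), ∃ y ∈ upperLie R b, x = e ^ k * y := by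
  induction k with
  | zero => intro x hx; exact ⟨x, by simpa using hx, by simp⟩
  | succ k ih =>
    intro x hx
    have hx' : x ∈ upperLie R (b + d + k * d) := by convert hx using 1; ring_nf
    obtain ⟨y, hy, rfl⟩ := upperLie_shift he h (k * d) x hx'
    obtain ⟨z, hz, rfl⟩ := ih y hy
    exact ⟨z, hz, by rw [pow_succ', mul_assoc]⟩

end UpperLie

/-! ### From vanishing terms to exact indices. -/

section Indices

variable {R : Type*} [Ring R] {U : Type*} [Group U]

theorem zero_mem_lieLowerSeries_succ (S : Set R) (k : ℕ) : 0 ∈ lieLowerSeries S (k + 1) :=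
  zero_mem (lieCommutator _ _)

theorem one_mem_groupLowerSeries_succ (H : Set U) (k : ℕ) : 1 ∈ groupLowerSeries H (k + 1) :=
  one_mem (groupCommutator _ _)

theorem commutator_mem_lieLowerSeries {S : Set R} {k : ℕ} {x y : R}
    (hx : x ∈ lieLowerSeries S k) (hy : y ∈ S) : x * y - y * x ∈ lieLowerSeries S (k + 1) :=
  AddSubgroup.subset_closure ⟨x, hx, y, hy, rfl⟩

theorem commutator_mem_groupLowerSeries {H : Set U} {k : ℕ} {x y : U}
    (hx : x ∈ groupLowerSeries H k) (hy : y ∈ H) :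
    x⁻¹ * y⁻¹ * x * y ∈ groupLowerSeries H (k + 1) :=
  Subgroup.subset_closure ⟨x, hx, y, hy, rfl⟩

theorem lieLowerSeries_eq_zero_of_le {S : Set R} {k l : ℕ} (h : lieLowerSeries S k = {0})
    (hkl : k ≤ l) : lieLowerSeries S l = {0} := by
  induction l, hkl using Nat.le_induction with
  | base => exact h
  | succ l _ ih =>
    refine Set.Subset.antisymm ?_ (Set.singleton_subset_iff.2 (zero_mem_lieLowerSeries_succ S l))
    change lieCommutator _ _ ≤ (⊥ : AddSubgroup R)
    rw [lieCommutator, AddSubgroup.closure_le, ih]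
    rintro _ ⟨x, rfl, y, -, rfl⟩
    simp

theorem groupLowerSeries_eq_one_of_le {H : Set U} {k l : ℕ} (h : groupLowerSeries H k = {1})
    (hkl : k ≤ l) : groupLowerSeries H l = {1} := by
  induction l, hkl using Nat.le_induction with
  | base => exact h
  | succ l _ ih =>
    refine Set.Subset.antisymm ?_ (Set.singleton_subset_iff.2 (one_mem_groupLowerSeries_succ H l))
    change groupCommutator _ _ ≤ (⊥ : Subgroup U)
    rw [groupCommutator, Subgroup.closure_le, ih]
    rintro _ ⟨x, rfl, y, -, rfl⟩
    simp

theorem lieNilpotencyIndex_eq_iff {S : Set R} {k : ℕ} (hk : 1 ≤ k)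
    (h : lieLowerSeries S k = {0}) :
    lieNilpotencyIndex S = ((k + 1 : ℕ) : ℕ∞) ↔ lieLowerSeries S (k - 1) ≠ {0} := by
  constructor
  · intro ht h'
    have h1 : lieNilpotencyIndex S ≤ ((k - 1 + 1 : ℕ) : ℕ∞) := iInf₂_le (k - 1) h'
    rw [ht, Nat.cast_le] at h1
    omega
  · intro h'
    refine le_antisymm (iInf₂_le k h) (le_iInf₂ fun l hl => ?_)
    rw [Nat.cast_le]
    by_contra hlt
    exact h' (lieLowerSeries_eq_zero_of_le hl (by omega))

theorem nilpotencyClass_eq_iff {H : Set U} {k : ℕ} (hk : 1 ≤ k)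
    (h : groupLowerSeries H k = {1}) :
    nilpotencyClass H = (k : ℕ∞) ↔ groupLowerSeries H (k - 1) ≠ {1} := by
  constructor
  · intro ht h'
    have h1 : nilpotencyClass H ≤ ((k - 1 : ℕ) : ℕ∞) := iInf₂_le (k - 1) h'
    rw [ht, Nat.cast_le] at h1
    omega
  · intro h'
    refine le_antisymm (iInf₂_le k h) (le_iInf₂ fun l hl => ?_)
    rw [Nat.cast_le]
    by_contra hlt
    exact h' (groupLowerSeries_eq_one_of_le hl (by omega))

/-- The index must be a successor: the initial term is S itself, which need not contain 0. -/
theorem lieLowerSeries_eq_zero_of_upperLie {k : ℕ} (S : Set R) (h : upperLie R (k + 1) = ⊥) :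
    lieLowerSeries S (k + 1) = {0} := by
  refine Set.Subset.antisymm ?_ (Set.singleton_subset_iff.2 (zero_mem_lieLowerSeries_succ S k))
  intro x hx
  have := lieLowerSeries_subset_upperLie S (k + 1) hx
  rw [h] at this
  simpa using this

theorem groupLowerSeries_eq_one_of_upperLie {k : ℕ} (H : Set Rˣ) (h : upperLie R (k + 1) = ⊥) :
    groupLowerSeries H (k + 1) = {1} := by
  refine Set.Subset.antisymm ?_ (Set.singleton_subset_iff.2 (one_mem_groupLowerSeries_succ H k))
  intro x hx
  have := groupLowerSeries_sub_one_mem_upperLie H (k + 1) x hx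
  rw [h, Ideal.mem_bot, sub_eq_zero, Units.val_eq_one] at this
  exact this

end Indices

/-! ### Bounded conjugacy classes give finitely many commutators. -/

section BFC

variable {G : Type*} [Group G]

/-- A group with a uniform bound on the sizes of its conjugacy classes has finitely many
commutators (B. H. Neumann). -/
theorem finite_commutatorSet_of_bounded_conjClasses (M : ℕ)
    (hM : ∀ g : G, ∃ T : Finset G, T.card ≤ M ∧ ∀ y, y⁻¹ * g * y ∈ T) :
    Finite (commutatorSet G) := by
  classical
  let cl : G → Set G := fun g => Set.range fun y => y⁻¹ * g * y
  have hfin : ∀ g, (cl g).Finite := fun g => by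
    obtain ⟨T, -, hT⟩ := hM g
    exact T.finite_toSet.subset (by rintro _ ⟨y, rfl⟩; exact hT y)
  have hbound : ∀ g, (cl g).ncard ≤ M := fun g => by
    obtain ⟨T, hT, hT'⟩ := hM g
    refine le_trans ?_ hT
    rw [← Set.ncard_coe_finset]
    exact Set.ncard_le_ncard (by rintro _ ⟨y, rfl⟩; exact hT' y) T.finite_toSet
  -- Fix a conjugacy class of maximal size.
  obtain ⟨a, ha⟩ : ∃ a, ∀ g, (cl g).ncard ≤ (cl a).ncard := by
    have hne : (Set.range fun g => (cl g).ncard).Nonempty := ⟨_, 1, rfl⟩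
    have hbdd : BddAbove (Set.range fun g => (cl g).ncard) :=
      ⟨M, by rintro _ ⟨g, rfl⟩; exact hbound g⟩
    obtain ⟨a, ha⟩ := Nat.sSup_mem hne hbdd
    exact ⟨a, fun g => (le_csSup hbdd ⟨g, rfl⟩).trans ha.ge⟩
  -- conjugators representing the class of `a`
  have hrep : ∀ s : cl a, ∃ t : G, t⁻¹ * a * t = s := fun s => s.2
  choose t ht using hrep
  have : Finite (cl a) := hfin a
  let f : G → (s : cl a) → cl (t s) := fun g s => ⟨g⁻¹ * t s * g, g, rfl⟩
  have : ∀ s, Finite (cl (t s)) := fun s => hfin _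
  have hf_range : (Set.range f).Finite := Set.toFinite _
  obtain ⟨Q, hQfin, hQ⟩ : ∃ Q : Set G, Q.Finite ∧ ∀ g, ∃ r ∈ Q, f r = f g := by
    have := hf_range.to_subtype
    choose q hq using fun z : Set.range f => z.2
    exact ⟨Set.range q, Set.toFinite _, fun g => ⟨q ⟨f g, g, rfl⟩, ⟨_, rfl⟩, hq ⟨f g, g, rfl⟩⟩⟩
  -- elements commuting with all conjugators have few commutators
  have hC : ∀ x : G, (∀ s, x * t s = t s * x) → ∀ g, ∃ u ∈ cl a, ∃ v ∈ cl a,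
      x⁻¹ * (g⁻¹ * x * g) = u * v⁻¹ := by
    intro x hx g
    have hsub : (fun u => x * u) '' cl a ⊆ cl (x * a) := by
      rintro _ ⟨u, hu, rfl⟩
      have h1 := ht ⟨u, hu⟩
      have h2 := hx ⟨u, hu⟩
      refine ⟨t ⟨u, hu⟩, ?_⟩
      generalize t ⟨u, hu⟩ = y at h1 h2
      simp only at h1 ⊢
      rw [← h1, ← mul_assoc y⁻¹, ← mul_assoc x, ← mul_assoc x]
      congr 2
      rw [inv_mul_eq_iff_eq_mul, ← mul_assoc, ← h2, mul_inv_cancel_right]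
    -- By maximality of cl a, the translate x · cl a fills the whole class of x * a.
    have heq : (fun u => x * u) '' cl a = cl (x * a) := by
      refine Set.eq_of_subset_of_ncard_le hsub ?_ (hfin _)
      rw [Set.ncard_image_of_injective _ (mul_right_injective x)]
      exact ha _
    have hmem : g⁻¹ * (x * a) * g ∈ cl (x * a) := ⟨g, rfl⟩
    rw [← heq] at hmem
    obtain ⟨u, hu, h⟩ := hmem
    refine ⟨u, hu, g⁻¹ * a * g, ⟨g, rfl⟩, ?_⟩
    simp only at h
    rw [eq_mul_inv_iff_mul_eq, mul_assoc, inv_mul_eq_iff_eq_mul, h]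
    group
  have hK : (⋃ r ∈ Q, ⋃ w ∈ cl r,
      Set.image2 (fun u v => r⁻¹ * (u * v⁻¹) * r * (r⁻¹ * w)) (cl a) (cl a)).Finite :=
    hQfin.biUnion fun r _ => (hfin r).biUnion fun w _ => (hfin a).image2 _ (hfin a)
  refine (hK.subset ?_).to_subtype
  rintro _ ⟨g, h, rfl⟩
  obtain ⟨r, hr, hrg⟩ := hQ g⁻¹
  -- Conjugation by r and by g⁻¹ agree on every t s, so g⁻¹r⁻¹ centralizes them all.
  have hx : ∀ s, (g⁻¹ * r⁻¹) * t s = t s * (g⁻¹ * r⁻¹) := by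
    intro s
    have h1 : r⁻¹ * t s * r = g⁻¹⁻¹ * t s * g⁻¹ := congrArg Subtype.val (congrFun hrg s)
    calc (g⁻¹ * r⁻¹) * t s = g⁻¹ * (r⁻¹ * t s * r) * r⁻¹ := by group
      _ = t s * (g⁻¹ * r⁻¹) := by rw [h1]; group
  obtain ⟨u, hu, v, hv, huv⟩ := hC _ hx h⁻¹
  simp only [Set.mem_iUnion]
  refine ⟨r, hr, h⁻¹⁻¹ * r * h⁻¹, ⟨h⁻¹, rfl⟩, u, hu, v, hv, ?_⟩
  simp only [← huv, commutatorElement_def]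
  group

end BFC
-- Group-theoretic consequences of Lie nilpotency.
section Structure

variable {F G : Type*} [Field F] [Group G]

/-- The conjugacy class of `s` has at most `B` elements. -/
def ConjBounded (B : ℕ) (s : G) : Prop :=
  ∃ T : Finset G, T.card ≤ B ∧ ∀ y, y⁻¹ * s * y ∈ T

/-- The coefficient of [w, y] at sy is w(s) - w(y⁻¹sy). If y moves s out of the support, then sy has
a bounded class, and so does s(sy), because sy conjugates s as y does. Then s is a quotient of two
elements with bounded classes. Otherwise the whole class of s lies in the support. -/
theorem conjBounded_of_commutator_support {w : MonoidAlgebra F G} {B K : ℕ}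
    (hK : w.coeff.support.card ≤ K)
    (h : ∀ y, ∀ s ∈ (w * MonoidAlgebra.of F G y - MonoidAlgebra.of F G y * w).coeff.support,
      ConjBounded B s) {s : G} (hs : s ∈ w.coeff.support) : ConjBounded (B * B + K) s := by
  classical
  have key : ∀ y, y⁻¹ * s * y ∉ w.coeff.support → ConjBounded B (s * y) := by
    intro y hy
    apply h y
    rw [Finsupp.mem_support_iff] at hs ⊢
    rw [Finsupp.notMem_support_iff] at hy
    simpa [MonoidAlgebra.coeff_mul_single_apply, MonoidAlgebra.coeff_single_mul_apply,
      ← mul_assoc, hy] using hs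
  by_cases hd : ∃ d, ConjBounded B d ∧ ConjBounded B (s * d)
  · obtain ⟨d, ⟨T, hT, hdT⟩, T', hT', hsT'⟩ := hd
    refine ⟨Finset.image₂ (fun u v => u * v⁻¹) T' T, ?_, fun y => ?_⟩
    · exact (Finset.card_image₂_le _ _ _).trans (by nlinarith)
    · refine Finset.mem_image₂.2 ⟨_, hsT' y, _, hdT y, by group⟩
  · push Not at hd
    refine ⟨w.coeff.support, by omega, fun y => ?_⟩
    by_contra hy
    have h1 := key y hy
    have h2 : (s * y)⁻¹ * s * (s * y) ∈ w.coeff.support := by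
      by_contra h2
      exact hd _ h1 (key _ h2)
    apply hy
    convert h2 using 1
    group

/-- Descending induction from the vanishing term; bracketing with a group element at most doubles
the support, whence 2 ^ k. -/
theorem exists_conjBounded_of_lieLowerSeries (j : ℕ) : ∀ k,
    lieLowerSeries (Set.univ : Set (MonoidAlgebra F G)) (k + j) = {0} →
    ∃ B, ∀ w ∈ lieLowerSeries (Set.univ : Set (MonoidAlgebra F G)) k,
      w.coeff.support.card ≤ 2 ^ k → ∀ s ∈ w.coeff.support, ConjBounded B s := by
  classical
  induction j with
  | zero =>
    intro k hk
    refine ⟨0, fun w hw _ s hs => ?_⟩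
    rw [Nat.add_zero] at hk
    rw [hk, Set.mem_singleton_iff] at hw
    simp [hw] at hs
  | succ j ih =>
    intro k hk
    obtain ⟨B, hB⟩ := ih (k + 1) (by rw [← hk]; congr 1; omega)
    refine ⟨B * B + 2 ^ k, fun w hw hcard s hs => conjBounded_of_commutator_support hcard ?_ hs⟩
    intro y
    apply hB _ (commutator_mem_lieLowerSeries hw (Set.mem_univ _))
    have h1 : (w * MonoidAlgebra.of F G y).coeff.support.card ≤ w.coeff.support.card :=
      (Finset.card_le_card (MonoidAlgebra.support_coeff_mul_single_subset _ _ _)).trans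
        Finset.card_image_le
    have h2 : (MonoidAlgebra.of F G y * w).coeff.support.card ≤ w.coeff.support.card :=
      (Finset.card_le_card (MonoidAlgebra.support_coeff_single_mul_subset _ _ _)).trans
        Finset.card_image_le
    rw [MonoidAlgebra.coeff_sub, pow_succ]
    refine (Finset.card_le_card Finsupp.support_sub).trans ((Finset.card_union_le _ _).trans ?_)
    omega

theorem finite_commutatorSet_of_isLieNilpotent
    (h : IsLieNilpotent (Set.univ : Set (MonoidAlgebra F G))) : Finite (commutatorSet G) := by
  obtain ⟨N, hN⟩ := h
  obtain ⟨B, hB⟩ := exists_conjBounded_of_lieLowerSeries N 0 (by rwa [Nat.zero_add])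
  refine finite_commutatorSet_of_bounded_conjClasses B fun g => ?_
  refine hB (MonoidAlgebra.single g 1) trivial ?_ g ?_
  · exact (Finset.card_le_card Finsupp.support_single_subset).trans (by simp)
  · simp

/-- In characteristic p, right minus left multiplication by g, raised to the power p ^ N, is the
same operator for g ^ p ^ N; for large N it vanishes. -/
theorem exists_pow_mem_center_of_isLieNilpotent (p : ℕ) [Fact p.Prime] [CharP F p]
    (h : IsLieNilpotent (Set.univ : Set (MonoidAlgebra F G))) (g : G) :
    ∃ k, g ^ p ^ k ∈ Subgroup.center G := by
  obtain ⟨N, hN⟩ := h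
  let a := MonoidAlgebra.of F G g
  let D : Module.End F (MonoidAlgebra F G) := LinearMap.mulRight F a - LinearMap.mulLeft F a
  have hD : ∀ k x, (D ^ k) x ∈ lieLowerSeries (Set.univ : Set (MonoidAlgebra F G)) k := by
    intro k
    induction k with
    | zero => intro x; trivial
    | succ k ih =>
      intro x
      rw [pow_succ', Module.End.mul_apply]
      exact commutator_mem_lieLowerSeries (ih x) (Set.mem_univ a)
  have : CharP (Module.End F (MonoidAlgebra F G)) p :=
    charP_of_injective_algebraMap (algebraMap F (Module.End F (MonoidAlgebra F G))).injective p
  have hcomm : Commute (LinearMap.mulRight F a) (LinearMap.mulLeft F a) := by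
    ext x; simp [mul_assoc]
  refine ⟨N, Subgroup.mem_center_iff.2 fun x => ?_⟩
  have hle : N ≤ p ^ N := (Nat.lt_pow_self (Fact.out : p.Prime).one_lt).le
  have hzero : (D ^ p ^ N) (MonoidAlgebra.of F G x) = 0 := by
    have := hD (p ^ N) (MonoidAlgebra.of F G x)
    rwa [lieLowerSeries_eq_zero_of_le hN hle, Set.mem_singleton_iff] at this
  rw [show D ^ p ^ N = _ from sub_pow_char_pow_of_commute _ _ hcomm, LinearMap.pow_mulRight,
    LinearMap.pow_mulLeft, LinearMap.sub_apply, LinearMap.mulRight_apply, LinearMap.mulLeft_apply,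
    sub_eq_zero, ← map_pow, ← map_mul, ← map_mul] at hzero
  exact MonoidAlgebra.of_injective hzero

/-- Pass to the subgroup generated by finitely many commutator representatives. Its centre has
p-power index, and the order of its commutator subgroup, equal to |G'|, divides a power of that
index. -/
theorem isPGroup_commutator (p : ℕ) [Fact p.Prime] [Finite (commutatorSet G)]
    (h : ∀ g : G, ∃ k, g ^ p ^ k ∈ Subgroup.center G) : IsPGroup p (commutator G) := by
  let H := closureCommutatorRepresentatives G
  have hq : IsPGroup p (H ⧸ Subgroup.center H) := by
    intro x
    obtain ⟨g, rfl⟩ := QuotientGroup.mk_surjective x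
    obtain ⟨k, hk⟩ := h g
    refine ⟨k, ?_⟩
    rw [← QuotientGroup.mk_pow, QuotientGroup.eq_one_iff, Subgroup.mem_center_iff]
    intro y
    ext
    simpa using Subgroup.mem_center_iff.1 hk y
  have hfi : (Subgroup.center H).FiniteIndex := inferInstance
  have : Finite (H ⧸ Subgroup.center H) := Subgroup.finite_quotient_of_finiteIndex
  obtain ⟨n, hn⟩ := IsPGroup.iff_card.1 hq
  have hdvd := Subgroup.card_commutator_dvd_index_center_pow H
  rw [Subgroup.index, hn, ← pow_mul, card_commutator_closureCommutatorRepresentatives] at hdvd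
  exact IsPGroup.of_card_dvd_pow hdvd

end Structure

open MonoidAlgebra (of)
open scoped commutatorElement

/-! ### Kernels of quotient maps of group algebras. -/

section Kernel

variable {F G : Type*} [Field F] [Group G]

theorem of_pow_sub_one (c : G) (j : ℕ) :
    of F G (c ^ j) - 1 = (of F G c - 1) * ∑ i ∈ Finset.range j, of F G c ^ i := by
  rw [mul_geom_sum, map_pow]

theorem of_mul_of_inv (g : G) : of F G g * of F G g⁻¹ = 1 := by
  rw [← map_mul, mul_inv_cancel, map_one]

theorem of_inv_mul_of (g : G) : of F G g⁻¹ * of F G g = 1 := by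
  rw [← map_mul, inv_mul_cancel, map_one]

/-- The kernel of the map of group algebras induced by the quotient by a finite cyclic normal
subgroup `⟨c⟩` is generated by `c - 1`. -/
theorem exists_eq_mul_of_map_eq_zero (N : Subgroup G) [N.Normal] {c : G}
    (hN : ∀ g ∈ N, ∃ j : ℕ, g = c ^ j) {x : MonoidAlgebra F G}
    (hx : MonoidAlgebra.mapDomainRingHom F (QuotientGroup.mk' N) x = 0) :
    ∃ y, x = (of F G c - 1) * y := by
  let S : MonoidAlgebra F (G ⧸ N) → MonoidAlgebra F G := MonoidAlgebra.mapDomain Quotient.out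
  have key : ∀ x : MonoidAlgebra F G, ∃ y,
      x - S (MonoidAlgebra.mapDomainRingHom F (QuotientGroup.mk' N) x) = (of F G c - 1) * y := by
    intro x
    induction x using MonoidAlgebra.induction_linear with
    | zero => exact ⟨0, by simp [S]⟩
    | add x y hx hy =>
      obtain ⟨u, hu⟩ := hx
      obtain ⟨v, hv⟩ := hy
      refine ⟨u + v, ?_⟩
      rw [mul_add, ← hu, ← hv, map_add]
      simp only [S, MonoidAlgebra.mapDomain_add]
      abel
    | single g r =>
      have hmem : g * (Quotient.out (g : G ⧸ N))⁻¹ ∈ N := by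
        have h1 : ((Quotient.out (g : G ⧸ N) : G) : G ⧸ N) = g := QuotientGroup.out_eq' _
        rw [← QuotientGroup.eq_one_iff, QuotientGroup.mk_mul, QuotientGroup.mk_inv, h1,
          mul_inv_cancel]
      obtain ⟨j, hj⟩ := hN _ hmem
      refine ⟨(∑ i ∈ Finset.range j, of F G c ^ i) *
        MonoidAlgebra.single (Quotient.out (g : G ⧸ N)) r, ?_⟩
      rw [← mul_assoc, ← of_pow_sub_one, ← hj, sub_mul, one_mul]
      simp [S, MonoidAlgebra.single_mul_single]
  obtain ⟨y, hy⟩ := key x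
  refine ⟨y, ?_⟩
  rw [← hy, hx]
  simp [S]

theorem mapDomainRingHom_mk_surjective (N : Subgroup G) [N.Normal] :
    Function.Surjective (MonoidAlgebra.mapDomainRingHom F (QuotientGroup.mk' N)) := by
  intro x
  induction x using MonoidAlgebra.induction_linear with
  | zero => exact ⟨0, map_zero _⟩
  | add x y hx hy =>
    obtain ⟨u, rfl⟩ := hx
    obtain ⟨v, rfl⟩ := hy
    exact ⟨u + v, map_add _ _ _⟩
  | single g r =>
    obtain ⟨g, rfl⟩ := QuotientGroup.mk_surjective g
    exact ⟨MonoidAlgebra.single g r, by simp⟩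

end Kernel

/-! ### Cyclic commutator subgroup: the action on a generator. -/

section Cyclic

variable {F G : Type*} [Field F] [Group G] {p : ℕ}

/-- All commutators are powers of `c`, on which the group acts trivially modulo `p`. -/
structure CyclicCommutators (p : ℕ) (c : G) : Prop where
  comm : ∀ g h : G, ∃ j : ℕ, ⁅g, h⁆ = c ^ j
  conj : ∀ g : G, ∃ m : ℕ, g * c * g⁻¹ = c ^ (1 + p * m)

theorem exists_eq_pow_of_mem_zpowers {c g : G} (hc : IsOfFinOrder c)
    (hg : g ∈ Subgroup.zpowers c) : ∃ j : ℕ, g = c ^ j := by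
  obtain ⟨j, hj⟩ := hc.mem_powers_iff_mem_zpowers.2 hg
  exact ⟨j, hj.symm⟩

theorem cyclicCommutators_of_eq_zpowers [Fact p.Prime] [Finite (commutator G)]
    (hP : IsPGroup p (commutator G)) (hZ : ∀ g : G, ∃ k, g ^ p ^ k ∈ Subgroup.center G) {c : G}
    (hc : commutator G = Subgroup.zpowers c) : CyclicCommutators p c := by
  have hcm : c ∈ commutator G := hc ▸ Subgroup.mem_zpowers c
  have hfin : IsOfFinOrder c := by
    exact (commutator G).subtype.isOfFinOrder (isOfFinOrder_of_finite (⟨c, hcm⟩ : commutator G))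
  refine ⟨fun g h => exists_eq_pow_of_mem_zpowers hfin ?_, fun g => ?_⟩
  · rw [← hc]
    exact Subgroup.commutator_mem_commutator (Subgroup.mem_top _) (Subgroup.mem_top _)
  by_cases h1 : c = 1
  · exact ⟨0, by simp [h1]⟩
  obtain ⟨n, hn⟩ : ∃ n : ℕ, g * c * g⁻¹ = c ^ n :=
    exists_eq_pow_of_mem_zpowers hfin (hc ▸ (inferInstance : (commutator G).Normal).conj_mem c hcm g)
  have hpow : ∀ t : ℕ, g ^ t * c * (g ^ t)⁻¹ = c ^ n ^ t := by
    intro t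
    induction t with
    | zero => simp
    | succ t ih =>
      calc g ^ (t + 1) * c * (g ^ (t + 1))⁻¹ = g ^ t * (g * c * g⁻¹) * (g ^ t)⁻¹ := by
            rw [pow_succ]; group
        _ = (g ^ t * c * (g ^ t)⁻¹) ^ n := by rw [hn, conj_pow]
        _ = c ^ n ^ (t + 1) := by rw [ih, ← pow_mul, pow_succ]
  obtain ⟨k, hk⟩ := hZ g
  -- A p-power of g is central, so n ^ p ^ k ≡ 1 modulo p, and Fermat gives n ≡ 1.
  have hfix : c ^ n ^ p ^ k = c ^ 1 := by
    rw [← hpow, ← Subgroup.mem_center_iff.1 hk c, mul_inv_cancel_right, pow_one]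
  have hpc : p ∣ orderOf c := by
    have h2 : (⟨c, hcm⟩ : commutator G) ≠ 1 := fun h => h1 (congrArg Subtype.val h)
    have h3 := hP.dvd_orderOf h2
    rwa [← Subgroup.orderOf_coe] at h3
  have hmod : n ^ p ^ k ≡ 1 [MOD p] := (pow_eq_pow_iff_modEq.1 hfix).of_dvd hpc
  have hn1 : n ≡ 1 [MOD p] := by
    rw [← ZMod.natCast_eq_natCast_iff] at hmod ⊢
    rwa [Nat.cast_pow, ZMod.pow_card_pow] at hmod
  have hp2 := (Fact.out : p.Prime).two_le
  have hn0 : 1 ≤ n := by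
    rcases Nat.eq_zero_or_pos n with h | h
    · subst h
      have := hn1.symm.dvd
      have h4 : (p : ℤ) ∣ 1 := by simpa using this
      have := Int.le_of_dvd one_pos h4
      omega
    · exact h
  obtain ⟨m, hm⟩ := (Nat.modEq_iff_dvd' hn0).1 hn1.symm
  exact ⟨m, by rw [hn]; congr 1; omega⟩

variable {c : G}

theorem CyclicCommutators.exists_mul_eq (hc : CyclicCommutators p c) (x : MonoidAlgebra F G) :
    ∃ y, x * (of F G c - 1) = (of F G c - 1) * y := by
  induction x using MonoidAlgebra.induction_on with
  | of g =>
    obtain ⟨m, hm⟩ := hc.conj g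
    refine ⟨(∑ i ∈ Finset.range (1 + p * m), of F G c ^ i) * of F G g, ?_⟩
    rw [← mul_assoc, ← of_pow_sub_one, ← hm, mul_sub, sub_mul, ← map_mul, ← map_mul]
    simp
  | add x y hx hy =>
    obtain ⟨u, hu⟩ := hx
    obtain ⟨v, hv⟩ := hy
    exact ⟨u + v, by rw [add_mul, hu, hv, mul_add]⟩
  | smul r x hx =>
    obtain ⟨u, hu⟩ := hx
    exact ⟨r • u, by rw [smul_mul_assoc, hu, mul_smul_comm]⟩

variable [Fact p.Prime] [CharP F p]

instance charP_monoidAlgebra : CharP (MonoidAlgebra F G) p :=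
  charP_of_injective_algebraMap (algebraMap F (MonoidAlgebra F G)).injective p

theorem of_sub_one_pow_prime_pow (c : G) (k : ℕ) :
    (of F G c - 1) ^ p ^ k = of F G (c ^ p ^ k) - 1 := by
  rw [sub_pow_char_pow_of_commute _ _ (Commute.one_right _), one_pow, map_pow]

end Cyclic

/-! ### The filtration by powers of c - 1. -/

section Filtration

variable {F G : Type*} [Field F] [Group G] {p : ℕ} {c : G}

theorem CyclicCommutators.exists_mul_pow_eq (hc : CyclicCommutators p c) (k : ℕ)
    (x : MonoidAlgebra F G) : ∃ y, x * (of F G c - 1) ^ k = (of F G c - 1) ^ k * y := by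
  induction k generalizing x with
  | zero => exact ⟨x, by simp⟩
  | succ k ih =>
    obtain ⟨y, hy⟩ := ih x
    obtain ⟨z, hz⟩ := hc.exists_mul_eq y
    exact ⟨z, by rw [pow_succ, ← mul_assoc, hy, mul_assoc, hz, mul_assoc]⟩

theorem commutator_of_of (g h : G) :
    of F G g * of F G h - of F G h * of F G g = (of F G ⁅g, h⁆ - 1) * (of F G h * of F G g) := by
  rw [sub_mul, one_mul, ← map_mul, ← map_mul, ← map_mul]
  congr 2
  rw [commutatorElement_def]
  group

theorem CyclicCommutators.exists_commutator_eq (hc : CyclicCommutators p c)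
    (x y : MonoidAlgebra F G) : ∃ z, x * y - y * x = (of F G c - 1) * z := by
  induction x using MonoidAlgebra.induction_on with
  | of g =>
    induction y using MonoidAlgebra.induction_on with
    | of h =>
      obtain ⟨j, hj⟩ := hc.comm g h
      exact ⟨_, by rw [commutator_of_of, hj, of_pow_sub_one, mul_assoc]⟩
    | add x y hx hy =>
      obtain ⟨u, hu⟩ := hx
      obtain ⟨v, hv⟩ := hy
      exact ⟨u + v, by rw [mul_add _ u, ← hu, ← hv]; noncomm_ring⟩
    | smul r x hx =>
      obtain ⟨u, hu⟩ := hx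
      exact ⟨r • u, by rw [mul_smul_comm _ _ u, ← hu, mul_smul_comm, smul_mul_assoc, smul_sub]⟩
  | add x y hx hy =>
    obtain ⟨u, hu⟩ := hx
    obtain ⟨v, hv⟩ := hy
    exact ⟨u + v, by rw [mul_add _ u, ← hu, ← hv]; noncomm_ring⟩
  | smul r x hx =>
    obtain ⟨u, hu⟩ := hx
    exact ⟨r • u, by rw [mul_smul_comm _ _ u, ← hu, mul_smul_comm, smul_mul_assoc, smul_sub]⟩

variable [Fact p.Prime] [CharP F p]

/-- The bracket of c - 1 with g is a multiple of c ^ (p * m) - 1, hence of c ^ p - 1 = (c - 1) ^ p;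
here p ≥ 3 is needed. -/
theorem CyclicCommutators.exists_commutator_self_eq (hc : CyclicCommutators p c) (hp : Odd p)
    (x : MonoidAlgebra F G) :
    ∃ y, (of F G c - 1) * x - x * (of F G c - 1) = (of F G c - 1) ^ 3 * y := by
  have hp3 : 3 ≤ p := by
    have := (Fact.out : p.Prime).two_le
    rcases hp with ⟨k, hk⟩
    omega
  induction x using MonoidAlgebra.induction_on with
  | of g =>
    obtain ⟨m, hm⟩ := hc.conj g
    have h1 : of F G (c ^ (p * m)) - 1 =
        (of F G c - 1) ^ 3 * ((of F G c - 1) ^ (p - 3) *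
          ∑ i ∈ Finset.range m, of F G (c ^ p) ^ i) := by
      have h := of_sub_one_pow_prime_pow (F := F) (p := p) c 1
      rw [pow_one] at h
      rw [← mul_assoc, ← pow_add, Nat.add_sub_cancel' hp3, h, ← of_pow_sub_one, pow_mul]
    have h2 : (of F G c - 1) * of F G g - of F G g * (of F G c - 1) =
        -((of F G (c ^ (p * m)) - 1) * (of F G c * of F G g)) := by
      have h3 : of F G g * of F G c = of F G (c ^ (p * m)) * (of F G c * of F G g) := by
        rw [← map_mul, ← map_mul, ← map_mul]
        congr 1
        rw [← mul_assoc, ← pow_succ, add_comm, ← hm, inv_mul_cancel_right]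
      rw [sub_mul, mul_sub, sub_mul, h3]
      noncomm_ring
    exact ⟨_, by rw [h2, h1, mul_assoc, ← mul_neg]⟩
  | add x y hx hy =>
    obtain ⟨u, hu⟩ := hx
    obtain ⟨v, hv⟩ := hy
    exact ⟨u + v, by rw [mul_add _ u, ← hu, ← hv]; noncomm_ring⟩
  | smul r x hx =>
    obtain ⟨u, hu⟩ := hx
    exact ⟨r • u, by rw [mul_smul_comm _ _ u, ← hu, mul_smul_comm, smul_mul_assoc, smul_sub]⟩

theorem CyclicCommutators.exists_commutator_pow_eq (hc : CyclicCommutators p c) (hp : Odd p)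
    (k : ℕ) (x : MonoidAlgebra F G) :
    ∃ y, (of F G c - 1) ^ k * x - x * (of F G c - 1) ^ k = (of F G c - 1) ^ (k + 2) * y := by
  induction k with
  | zero => exact ⟨0, by simp⟩
  | succ k ih =>
    obtain ⟨u, hu⟩ := ih
    obtain ⟨v, hv⟩ := hc.exists_commutator_self_eq hp x
    obtain ⟨w, hw⟩ := hc.exists_mul_pow_eq k v
    refine ⟨u + w, ?_⟩
    have h : (of F G c - 1) ^ (k + 1) * x - x * (of F G c - 1) ^ (k + 1) =
        (of F G c - 1) * ((of F G c - 1) ^ k * x - x * (of F G c - 1) ^ k) +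
          ((of F G c - 1) * x - x * (of F G c - 1)) * (of F G c - 1) ^ k := by
      rw [pow_succ']
      noncomm_ring
    rw [h, hu, hv, mul_assoc _ v, hw, mul_add, ← mul_assoc, ← mul_assoc, ← pow_succ', ← pow_add]
    congr 3
    ring

/-- Modulo `(c - 1)ᵏ⁺²`, Lie commutators commute with multiplication by `(c - 1)ᵏ`. -/
theorem CyclicCommutators.exists_commutator_pow_mul_eq (hc : CyclicCommutators p c) (hp : Odd p)
    (k : ℕ) (x y : MonoidAlgebra F G) :
    ∃ z, (of F G c - 1) ^ k * x * y - y * ((of F G c - 1) ^ k * x) =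
      (of F G c - 1) ^ k * (x * y - y * x) + (of F G c - 1) ^ (k + 2) * z := by
  obtain ⟨u, hu⟩ := hc.exists_commutator_pow_eq hp k y
  refine ⟨u * x, ?_⟩
  rw [← mul_assoc _ u, ← hu]
  noncomm_ring

theorem CyclicCommutators.upperLie_le (hc : CyclicCommutators p c) (hp : Odd p) (k : ℕ) :
    ∀ x ∈ upperLie (MonoidAlgebra F G) k, ∃ y, x = (of F G c - 1) ^ k * y := by
  induction k with
  | zero => intro x _; exact ⟨x, by simp⟩
  | succ k ih =>
    refine upperLie_succ_induction (fun x hx y => ?_) ⟨0, by simp⟩ ?_ ?_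
    · obtain ⟨u, rfl⟩ := ih x hx
      obtain ⟨v, hv⟩ := hc.exists_commutator_pow_mul_eq hp k u y
      obtain ⟨w, hw⟩ := hc.exists_commutator_eq u y
      refine ⟨w + (of F G c - 1) * v, ?_⟩
      rw [hv, hw, mul_add, ← mul_assoc, ← mul_assoc, ← pow_succ, ← pow_succ]
    · rintro _ _ ⟨x, rfl⟩ ⟨y, rfl⟩
      exact ⟨x + y, (mul_add _ _ _).symm⟩
    · rintro r _ ⟨x, rfl⟩
      obtain ⟨w, hw⟩ := hc.exists_mul_pow_eq (k + 1) r
      exact ⟨w * x, by rw [← mul_assoc, hw, mul_assoc]⟩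

theorem upperLie_card_eq_bot_of_isCyclic [Finite (commutator G)] (hp : Odd p)
    (hP : IsPGroup p (commutator G)) (hZ : ∀ g : G, ∃ k, g ^ p ^ k ∈ Subgroup.center G)
    (hcyc : IsCyclic (commutator G)) :
    upperLie (MonoidAlgebra F G) (Nat.card (commutator G)) = ⊥ := by
  obtain ⟨c, hc⟩ := Subgroup.isCyclic_iff_exists_zpowers_eq_top (commutator G) |>.1 hcyc
  have hcc := cyclicCommutators_of_eq_zpowers hP hZ hc.symm
  obtain ⟨n, hn⟩ := IsPGroup.iff_card.1 hP
  rw [eq_bot_iff]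
  intro x hx
  obtain ⟨y, rfl⟩ := hcc.upperLie_le hp _ x hx
  rw [hn, of_sub_one_pow_prime_pow, ← hn, ← hc, Nat.card_zpowers, pow_orderOf_eq_one,
    map_one, sub_self, zero_mul]
  exact zero_mem _

end Filtration

/-! ### Preparation for the noncyclic case. -/

section NonCyclic

variable {p : ℕ}

theorem of_sub_one_mem_upperLie (F : Type*) {G : Type*} [Field F] [Group G] {k : G}
    (hk : k ∈ commutator G) : of F G k - 1 ∈ upperLie (MonoidAlgebra F G) 1 := by
  rw [commutator_eq_closure] at hk
  induction hk using Subgroup.closure_induction with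
  | mem x hx =>
    obtain ⟨g, h, rfl⟩ := hx
    have h1 : of F G ⁅g, h⁆ - 1 =
        (of F G g * of F G h - of F G h * of F G g) * (of F G g⁻¹ * of F G h⁻¹) := by
      rw [commutator_of_of, mul_assoc, mul_assoc, ← mul_assoc _ (of F G g⁻¹), of_mul_of_inv,
        one_mul, of_mul_of_inv, mul_one]
    rw [h1]
    exact mul_mem_upperLie (commutator_mem_upperLie (k := 0) trivial _) _
  | one => rw [map_one, sub_self]; exact zero_mem _
  | mul x y _ _ hx hy =>
    have h1 : of F G (x * y) - 1 = of F G x * (of F G y - 1) + (of F G x - 1) := by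
      rw [map_mul]; noncomm_ring
    rw [h1]
    exact add_mem (Ideal.mul_mem_left _ _ hy) hx
  | inv x _ hx =>
    have h1 : of F G x⁻¹ - 1 = -of F G x⁻¹ * (of F G x - 1) := by
      rw [mul_sub, neg_mul, of_inv_mul_of]; noncomm_ring
    rw [h1]
    exact Ideal.mul_mem_left _ _ hx

/-- G acts on G' by conjugation through a p-group, so the identity is not the only fixed point; a
power of another one has order p. -/
theorem exists_central_of_order_prime {G : Type*} [Group G] [Fact p.Prime] [Finite (commutator G)]
    [Nontrivial (commutator G)] (hP : IsPGroup p (commutator G))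
    (hZ : ∀ g : G, ∃ k, g ^ p ^ k ∈ Subgroup.center G) :
    ∃ c ∈ commutator G, c ∈ Subgroup.center G ∧ orderOf c = p := by
  let φ : G →* MulAut (commutator G) := MulAut.conjNormal
  have hφ : IsPGroup p φ.range := by
    rintro ⟨_, g, rfl⟩
    obtain ⟨k, hk⟩ := hZ g
    refine ⟨k, ?_⟩
    ext x
    have := Subgroup.mem_center_iff.1 hk x
    simp only [Subgroup.coe_pow, ← map_pow, φ, MulAut.conjNormal_apply, Subgroup.coe_one,
      MulAut.one_apply]
    rw [← this, mul_inv_cancel_right]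
  have hdvd : p ∣ Nat.card (commutator G) := by
    rcases hP.card_eq_or_dvd with h | h
    · exact absurd h (Finite.one_lt_card.ne')
    · exact h
  obtain ⟨b, hb, hb1⟩ := hφ.exists_fixed_point_of_prime_dvd_card_of_fixed_point
    (commutator G) hdvd (a := 1) (fun x => by simp)
  have hbc : (b : G) ∈ Subgroup.center G := by
    rw [Subgroup.mem_center_iff]
    intro g
    have h := congrArg Subtype.val (hb ⟨φ g, g, rfl⟩)
    simp only [Subgroup.smul_def, MulAut.smul_def, φ, MulAut.conjNormal_apply] at h
    rw [← mul_inv_eq_iff_eq_mul, h]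
  obtain ⟨k, hk⟩ := IsPGroup.iff_orderOf.1 hP b
  have hk0 : k ≠ 0 := by
    rintro rfl
    rw [pow_zero, orderOf_eq_one_iff] at hk
    exact hb1 hk.symm
  refine ⟨(b : G) ^ p ^ (k - 1), pow_mem b.2 _, pow_mem hbc _, ?_⟩
  have hp0 := (Fact.out : p.Prime).pos
  rw [orderOf_pow_of_dvd (by positivity), Subgroup.orderOf_coe, hk,
    Nat.pow_div (Nat.sub_le _ _) hp0, Nat.sub_sub_self (by omega), pow_one]
  rw [Subgroup.orderOf_coe, hk]
  exact pow_dvd_pow _ (Nat.sub_le _ _)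

/-- If all terms lie in a two-sided ideal power, the difference `Xⁿ - Yⁿ` of commuting elements
factors as `(X - Y)` times an element of the ideal. -/
theorem exists_pow_sub_pow_eq {R : Type*} [Ring R] {X Y : R} (h : Commute X Y) {k : ℕ}
    (hX : X ∈ upperLie R k) (hY : Y ∈ upperLie R k) {n : ℕ} (hn : 2 ≤ n) :
    ∃ w ∈ upperLie R k, X ^ n - Y ^ n = (X - Y) * w := by
  refine ⟨_, sum_mem fun i hi => ?_, (h.mul_geom_sum₂ n).symm⟩
  rcases Nat.eq_zero_or_pos i with rfl | hi0
  · rw [pow_zero, one_mul]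
    exact Ideal.pow_mem_of_mem _ hY _ (by omega)
  · exact mul_mem_upperLie (Ideal.pow_mem_of_mem _ hX _ hi0) _

end NonCyclic

/-! ### Gaining a central factor c - 1 when the quotient is cyclic. -/

section NonCyclicStep

variable {F G : Type*} [Field F] [Group G] {p : ℕ} [Fact p.Prime] [CharP F p]

theorem of_sub_one_central {c : G} (hc : c ∈ Subgroup.center G) (x : MonoidAlgebra F G) :
    (of F G c - 1) * x = x * (of F G c - 1) := by
  have h : Commute (of F G c) x :=
    MonoidAlgebra.of_commute (fun m => (Subgroup.mem_center_iff.1 hc m).symm) x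
  rw [sub_mul, mul_sub, h.eq, one_mul, mul_one]

variable {c d : G} {k : ℕ}

theorem exists_upperLie_eq_of_quotient (N : Subgroup G) [N.Normal]
    (hN : ∀ g ∈ N, ∃ j : ℕ, g = c ^ j) (hp : Odd p) (hd : CyclicCommutators p (d : G ⧸ N)) (m : ℕ)
    {x : MonoidAlgebra F G} (hx : x ∈ upperLie (MonoidAlgebra F G) m) :
    ∃ y z, x = (of F G d - 1) ^ m * y + (of F G c - 1) * z := by
  let π := MonoidAlgebra.mapDomainRingHom F (QuotientGroup.mk' N)
  obtain ⟨y', hy'⟩ := hd.upperLie_le hp m _ (map_mem_upperLie π m x hx)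
  obtain ⟨y, rfl⟩ := mapDomainRingHom_mk_surjective N y'
  obtain ⟨z, hz⟩ := exists_eq_mul_of_map_eq_zero N hN (x := x - (of F G d - 1) ^ m * y) (by
    have h1 : π (of F G d) = of F (G ⧸ N) (d : G ⧸ N) := by simp [π]
    change π _ = 0
    rw [map_sub, map_mul, map_pow, map_sub, map_one, h1, hy']
    exact sub_self _)
  exact ⟨y, z, by rw [← hz]; abel⟩

/-- Modulo c - 1 the element x is a multiple of d - 1, which (d - 1) ^ (p ^ k - 1) annihilates. A
factor d - 1 survives next to c - 1 and keeps the cofactor in the ideal. -/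
theorem exists_pow_sub_one_mul_eq (hk : 1 ≤ k) (hdG : d ∈ commutator G)
    (hdr : d ^ p ^ k = 1)
    (hcz : c ∈ Subgroup.center G) (N : Subgroup G) [N.Normal]
    (hN : ∀ g ∈ N, ∃ j : ℕ, g = c ^ j) (hp : Odd p) (hd : CyclicCommutators p (d : G ⧸ N))
    {x : MonoidAlgebra F G} (hx : x ∈ upperLie (MonoidAlgebra F G) 1) :
    ∃ w ∈ upperLie (MonoidAlgebra F G) 1,
      (of F G d - 1) ^ (p ^ k - 1) * x = (of F G c - 1) * w := by
  have hr : 2 ≤ p ^ k := (Fact.out : p.Prime).two_le.trans (Nat.le_self_pow (by omega) p)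
  obtain ⟨y, z, rfl⟩ := exists_upperLie_eq_of_quotient N hN hp hd 1 hx
  refine ⟨(of F G d - 1) ^ (p ^ k - 1) * z, mul_mem_upperLie
    (Ideal.pow_mem_of_mem _ (of_sub_one_mem_upperLie F hdG) _ (by omega)) _, ?_⟩
  rw [pow_one, mul_add, ← mul_assoc, ← pow_succ, Nat.sub_add_cancel (by omega),
    of_sub_one_pow_prime_pow, hdr, map_one, sub_self, zero_mul, zero_add, ← mul_assoc,
    ← of_sub_one_central hcz, mul_assoc]

/-- Up to sign and a factor g, the bracket with g is Xⁿ - Yⁿ, where X = gdg⁻¹ - 1, Y = d^(1+pm) - 1,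
n = p ^ k - 1. Here c - 1 divides X - Y, and n ≥ 2 puts the cofactor in the ideal. -/
theorem exists_commutator_pow_sub_one_eq (hk : 1 ≤ k) (hdG : d ∈ commutator G) (hdr : d ^ p ^ k = 1)
    (hcz : c ∈ Subgroup.center G) (N : Subgroup G) [N.Normal]
    (hN : ∀ g ∈ N, ∃ j : ℕ, g = c ^ j) (hp : Odd p) (hd : CyclicCommutators p (d : G ⧸ N))
    (x : MonoidAlgebra F G) :
    ∃ w ∈ upperLie (MonoidAlgebra F G) 1,
      (of F G d - 1) ^ (p ^ k - 1) * x - x * (of F G d - 1) ^ (p ^ k - 1) =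
        (of F G c - 1) * w := by
  have hp3 : 3 ≤ p := by
    have := (Fact.out : p.Prime).two_le
    rcases hp with ⟨k, hk⟩
    omega
  have hr : 3 ≤ p ^ k := hp3.trans (Nat.le_self_pow (by omega) p)
  set n := p ^ k - 1 with hn
  have hfn : (of F G d - 1) ^ n * of F G d = (of F G d - 1) ^ n := by
    have h : (of F G d - 1) ^ n * (of F G d - 1) = 0 := by
      rw [← pow_succ, hn, Nat.sub_add_cancel (by omega), of_sub_one_pow_prime_pow, hdr, map_one,
        sub_self]
    rwa [mul_sub, mul_one, sub_eq_zero] at h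
  induction x using MonoidAlgebra.induction_on with
  | of g =>
    obtain ⟨m, hm⟩ := hd.conj g
    have hmem : g * d * g⁻¹ * (d ^ (1 + p * m))⁻¹ ∈ N := by
      rw [← QuotientGroup.eq_one_iff]
      change (g : G ⧸ N) * d * (g : G ⧸ N)⁻¹ * ((d : G ⧸ N) ^ (1 + p * m))⁻¹ = 1
      rw [hm, mul_inv_cancel]
    obtain ⟨i, hi⟩ := hN _ hmem
    rw [mul_inv_eq_iff_eq_mul] at hi
    -- `(d ^ (1 + p m) - 1) ^ n = (d - 1) ^ n`
    have hY : (of F G (d ^ (1 + p * m)) - 1) ^ n = (of F G d - 1) ^ n := by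
      have hcomm : Commute (of F G d - 1) (∑ i ∈ Finset.range (1 + p * m), of F G d ^ i) :=
        Commute.sum_right _ _ _ fun i _ =>
          ((Commute.refl _).pow_right i).sub_left (Commute.one_left _)
      have hpow : ∀ i, (of F G d - 1) ^ n * of F G d ^ i = (of F G d - 1) ^ n := by
        intro i
        induction i with
        | zero => simp
        | succ i ih => rw [pow_succ, ← mul_assoc, ih, hfn]
      -- Each power of d fixes (d - 1) ^ n, so the sum acts as the scalar 1 + p m = 1.
      have hsum : (of F G d - 1) ^ n * (∑ i ∈ Finset.range (1 + p * m), of F G d ^ i) =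
          (of F G d - 1) ^ n := by
        rw [Finset.mul_sum, Finset.sum_congr rfl fun i _ => hpow i, Finset.sum_const,
          Finset.card_range, nsmul_eq_mul, Nat.cast_add, Nat.cast_mul,
          CharP.cast_eq_zero (MonoidAlgebra F G) p]
        simp
      have hsumpow : ∀ j, (of F G d - 1) ^ n *
          (∑ i ∈ Finset.range (1 + p * m), of F G d ^ i) ^ j = (of F G d - 1) ^ n := by
        intro j
        induction j with
        | zero => simp
        | succ j ih => rw [pow_succ, ← mul_assoc, ih, hsum]
      rw [of_pow_sub_one, hcomm.mul_pow, hsumpow]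
    have hX : (of F G (g * d * g⁻¹) - 1) ^ n = of F G g * (of F G d - 1) ^ n * of F G g⁻¹ := by
      have h1 : ∀ j, (of F G (g * d * g⁻¹) - 1) ^ j =
          of F G g * (of F G d - 1) ^ j * of F G g⁻¹ := by
        intro j
        induction j with
        | zero => rw [pow_zero, pow_zero, mul_one, of_mul_of_inv]
        | succ j ih =>
          have h2 : of F G (g * d * g⁻¹) - 1 = of F G g * (of F G d - 1) * of F G g⁻¹ := by
            rw [mul_sub, sub_mul, mul_one, of_mul_of_inv, map_mul, map_mul]
          rw [pow_succ, ih, h2, pow_succ]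
          simp only [mul_assoc]
          rw [← mul_assoc (of F G g⁻¹), of_inv_mul_of, one_mul]
      exact h1 n
    have hcommXY : Commute (of F G (g * d * g⁻¹) - 1) (of F G (d ^ (1 + p * m)) - 1) := by
      have hcd : Commute (c ^ i) (d ^ (1 + p * m)) :=
        (Subgroup.mem_center_iff.1 (pow_mem hcz i) _).symm
      have h : Commute (g * d * g⁻¹) (d ^ (1 + p * m)) := by
        rw [hi]
        exact hcd.mul_left (Commute.refl _)
      exact ((h.map (of F G)).sub_left (Commute.one_left _)).sub_right (Commute.one_right _)
    obtain ⟨w, hw, hXY⟩ := exists_pow_sub_pow_eq hcommXY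
      (of_sub_one_mem_upperLie F ((inferInstance : (commutator G).Normal).conj_mem d hdG g))
      (of_sub_one_mem_upperLie F (pow_mem hdG _)) (n := n) (by omega)
    have hdiff : of F G (g * d * g⁻¹) - 1 - (of F G (d ^ (1 + p * m)) - 1) =
        (of F G c - 1) * ((∑ j ∈ Finset.range i, of F G c ^ j) * of F G (d ^ (1 + p * m))) := by
      rw [← mul_assoc, ← of_pow_sub_one, hi, sub_mul, one_mul, map_mul]
      abel
    refine ⟨-((∑ j ∈ Finset.range i, of F G c ^ j) * of F G (d ^ (1 + p * m)) * w) * of F G g,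
      mul_mem_upperLie (neg_mem (Ideal.mul_mem_left _ _ hw)) _, ?_⟩
    have h3 : (of F G d - 1) ^ n * of F G g - of F G g * (of F G d - 1) ^ n =
        -((of F G (g * d * g⁻¹) - 1) ^ n - (of F G (d ^ (1 + p * m)) - 1) ^ n) * of F G g := by
      rw [hX, hY, neg_sub, sub_mul, mul_assoc _ (of F G g⁻¹), of_inv_mul_of, mul_one]
    rw [h3, hXY, hdiff]
    noncomm_ring
  | add x y hx hy =>
    obtain ⟨u, hu, hu'⟩ := hx
    obtain ⟨v, hv, hv'⟩ := hy
    exact ⟨u + v, add_mem hu hv, by rw [mul_add _ u, ← hu', ← hv']; noncomm_ring⟩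
  | smul r x hx =>
    obtain ⟨u, hu, hu'⟩ := hx
    exact ⟨r • u, Submodule.smul_of_tower_mem _ r hu,
      by rw [mul_smul_comm _ _ u, ← hu', mul_smul_comm, smul_mul_assoc, smul_sub]⟩

/-- The cofactor stays at index 1, so the step can be iterated: every further p ^ k - 1 brackets
give another factor c - 1. -/
theorem upperLie_prime_pow_le (hk : 1 ≤ k) (hdG : d ∈ commutator G) (hdr : d ^ p ^ k = 1)
    (hcz : c ∈ Subgroup.center G) (N : Subgroup G) [N.Normal]
    (hN : ∀ g ∈ N, ∃ j : ℕ, g = c ^ j) (hp : Odd p) (hd : CyclicCommutators p (d : G ⧸ N)) :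
    ∀ x ∈ upperLie (MonoidAlgebra F G) (p ^ k - 1 + 1), ∃ w ∈ upperLie (MonoidAlgebra F G) 1,
      x = (of F G c - 1) * w := by
  refine upperLie_succ_induction (fun x hx s => ?_) ⟨0, zero_mem _, by simp⟩ ?_ ?_
  · obtain ⟨y, z, rfl⟩ := exists_upperLie_eq_of_quotient N hN hp hd _ hx
    obtain ⟨u, hu, hu'⟩ := exists_pow_sub_one_mul_eq hk hdG hdr hcz N hN hp hd
      (commutator_mem_upperLie (k := 0) (x := y) trivial s)
    obtain ⟨v, hv, hv'⟩ := exists_commutator_pow_sub_one_eq hk hdG hdr hcz N hN hp hd s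
    refine ⟨u + v * y + (z * s - s * z), add_mem (add_mem hu (mul_mem_upperLie hv y))
      (commutator_mem_upperLie (k := 0) trivial s), ?_⟩
    have hcs := of_sub_one_central (F := F) hcz s
    calc _ = (of F G d - 1) ^ (p ^ k - 1) * (y * s - s * y) +
          ((of F G d - 1) ^ (p ^ k - 1) * s - s * (of F G d - 1) ^ (p ^ k - 1)) * y +
          ((of F G c - 1) * (z * s) - s * (of F G c - 1) * z) := by
            generalize (of F G d - 1) ^ (p ^ k - 1) = f
            generalize of F G c - 1 = e
            noncomm_ring
      _ = _ := by
            rw [hu', hv', ← hcs, mul_assoc, mul_assoc]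
            generalize of F G c - 1 = e
            noncomm_ring
  · rintro _ _ ⟨x, hx, rfl⟩ ⟨y, hy, rfl⟩
    exact ⟨x + y, add_mem hx hy, (mul_add _ _ _).symm⟩
  · rintro r _ ⟨x, hx, rfl⟩
    exact ⟨r * x, Ideal.mul_mem_left _ _ hx, by
      rw [← mul_assoc, ← mul_assoc, of_sub_one_central hcz]⟩

end NonCyclicStep

/-! ### The noncyclic case by induction on |G'|. -/

section NonCyclic

universe u

theorem map_mk_commutator {G : Type*} [Group G] (N : Subgroup G) [N.Normal] :
    (commutator G).map (QuotientGroup.mk' N) = commutator (G ⧸ N) := by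
  rw [commutator_def, commutator_def, Subgroup.map_commutator,
    Subgroup.map_top_of_surjective _ (QuotientGroup.mk'_surjective N)]

theorem card_commutator_quotient {G : Type*} [Group G] (N : Subgroup G) [N.Normal]
    (hN : N ≤ commutator G) :
    Nat.card (commutator G) = Nat.card N * Nat.card (commutator (G ⧸ N)) := by
  let f : commutator G →* G ⧸ N := (QuotientGroup.mk' N).comp (commutator G).subtype
  have h1 : f.range = commutator (G ⧸ N) := by
    rw [MonoidHom.range_comp, Subgroup.range_subtype, map_mk_commutator]
  have h2 : f.ker = N.subgroupOf (commutator G) := by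
    ext x
    simp [f, MonoidHom.mem_ker, Subgroup.mem_subgroupOf]
  have h3 := f.ker.card_mul_index
  rw [Subgroup.index_ker, h1, h2, Nat.card_congr (Subgroup.subgroupOfEquivOfLe hN).toEquiv] at h3
  exact h3.symm

theorem upperLie_eq_bot_of_not_isCyclic {F : Type*} [Field F] {p : ℕ} [Fact p.Prime] [CharP F p]
    (hp : Odd p) (n : ℕ) : ∀ (G : Type u) [Group G] [Finite (commutator G)],
    IsPGroup p (commutator G) → (∀ g : G, ∃ k, g ^ p ^ k ∈ Subgroup.center G) →
    ¬ IsCyclic (commutator G) → Nat.card (commutator G) = n →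
    upperLie (MonoidAlgebra F G) (n - 1) = ⊥ := by
  induction n using Nat.strong_induction_on with
  | _ n ih =>
    intro G _ _ hP hZ hcyc hcard
    have hp2 := (Fact.out : p.Prime).two_le
    have hnt : Nontrivial (commutator G) := by
      by_contra h
      rw [not_nontrivial_iff_subsingleton] at h
      exact hcyc isCyclic_of_subsingleton
    obtain ⟨c, hcG, hcz, hcp⟩ := exists_central_of_order_prime hP hZ
    let N := Subgroup.zpowers c
    have hNc : N ≤ Subgroup.center G := Subgroup.zpowers_le.2 hcz
    have hNG : N ≤ commutator G := Subgroup.zpowers_le.2 hcG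
    have hNn : N.Normal := ⟨fun x hx g => by
      rw [Subgroup.mem_center_iff.1 (hNc hx) g, mul_inv_cancel_right]; exact hx⟩
    have hcfin : IsOfFinOrder c := by rw [← orderOf_pos_iff, hcp]; omega
    have hN : ∀ g ∈ N, ∃ j : ℕ, g = c ^ j := fun g hg => exists_eq_pow_of_mem_zpowers hcfin hg
    have hcardN : Nat.card N = p := by rw [Nat.card_zpowers, hcp]
    have hcardQ := card_commutator_quotient N hNG
    rw [hcard, hcardN] at hcardQ
    have hmap := map_mk_commutator N
    have hQP : IsPGroup p (commutator (G ⧸ N)) := hmap ▸ hP.map _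
    have hQfin : Finite (commutator (G ⧸ N)) := by
      rw [← hmap]
      exact ((commutator G : Set G).toFinite.image _).to_subtype
    have hQZ : ∀ g : G ⧸ N, ∃ k, g ^ p ^ k ∈ Subgroup.center (G ⧸ N) := by
      intro g
      obtain ⟨g, rfl⟩ := QuotientGroup.mk_surjective g
      obtain ⟨k, hk⟩ := hZ g
      refine ⟨k, Subgroup.mem_center_iff.2 fun x => ?_⟩
      obtain ⟨x, rfl⟩ := QuotientGroup.mk_surjective x
      exact congrArg (QuotientGroup.mk' N) (Subgroup.mem_center_iff.1 hk x)
    set r := Nat.card (commutator (G ⧸ N)) with hr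
    have hr0 : 0 < r := Nat.card_pos
    have hep : (of F G c - 1) ^ p = 0 := by
      have h := of_sub_one_pow_prime_pow (F := F) (p := p) c 1
      rw [pow_one] at h
      rw [h, ← hcp, pow_orderOf_eq_one, map_one, sub_self]
    have hmul : p ≤ p * r := Nat.le_mul_of_pos_right _ hr0
    by_cases hQcyc : IsCyclic (commutator (G ⧸ N))
    · obtain ⟨D, hD⟩ := Subgroup.isCyclic_iff_exists_zpowers_eq_top _ |>.1 hQcyc
      have hDm : D ∈ (commutator G).map (QuotientGroup.mk' N) := by
        rw [hmap, ← hD]; exact Subgroup.mem_zpowers D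
      obtain ⟨d, hdG, rfl⟩ := hDm
      have hcc : CyclicCommutators p (d : G ⧸ N) := cyclicCommutators_of_eq_zpowers hQP hQZ hD.symm
      obtain ⟨k, hk⟩ := IsPGroup.iff_card.1 hQP
      have hordD : orderOf (d : G ⧸ N) = r := by
        rw [← Nat.card_zpowers, hr]
        exact congrArg (fun H : Subgroup (G ⧸ N) => Nat.card H) hD
      have hk1 : 1 ≤ k := by
        by_contra hk0
        have hk0 : k = 0 := by omega
        rw [hr, hk, hk0] at hcardQ
        exact hcyc (isCyclic_of_prime_card (p := p) (by rw [hcard, hcardQ, pow_zero, mul_one]))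
      -- Otherwise d would have order p * r = |G'| and generate G'.
      have hdr : d ^ p ^ k = 1 := by
        by_contra hne
        have h1 : r ∣ orderOf d := hordD ▸ orderOf_map_dvd (QuotientGroup.mk' N) d
        have h2 : orderOf d ∣ p * r := by
          rw [← hcardQ, ← hcard, ← Subgroup.orderOf_mk d hdG]
          exact orderOf_dvd_natCard _
        obtain ⟨t, ht⟩ := h1
        rw [ht, mul_comm p r] at h2
        rcases (Nat.dvd_prime (Fact.out : p.Prime)).1 (Nat.dvd_of_mul_dvd_mul_left hr0 h2)
          with h | h
        · rw [h, mul_one] at ht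
          exact hne (by rw [← hk, ← hr, ← ht, pow_orderOf_eq_one])
        · refine hcyc (isCyclic_of_orderOf_eq_card (⟨d, hdG⟩ : commutator G) ?_)
          rw [Subgroup.orderOf_mk, ht, h, hcard, hcardQ, mul_comm]
      have hmain := upperLie_prime_pow_le (F := F) hk1 hdG hdr hcz N hN hp hcc
      rw [← hk, ← hr, add_comm] at hmain
      have hshift := upperLie_shift_pow (of_sub_one_central hcz) hmain p
      rw [eq_bot_iff]
      intro x hx
      -- p ≥ 2 absorbs the initial bracket: 1 + p(r - 1) ≤ pr - 1.
      have hle : 1 + p * (r - 1) ≤ n - 1 := by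
        rw [hcardQ, Nat.mul_sub, mul_one]; omega
      obtain ⟨y, -, rfl⟩ := hshift x (upperLie_antitone hle hx)
      rw [hep, zero_mul]
      exact zero_mem _
    · have hrn : r < n := by rw [hcardQ]; nlinarith
      have hbot := ih r hrn (G ⧸ N) hQP hQZ hQcyc rfl
      have hmain : ∀ x ∈ upperLie (MonoidAlgebra F G) (0 + (r - 1)),
          ∃ y ∈ upperLie (MonoidAlgebra F G) 0, x = (of F G c - 1) * y := by
        intro x hx
        rw [zero_add] at hx
        have h0 := map_mem_upperLie (MonoidAlgebra.mapDomainRingHom F (QuotientGroup.mk' N)) _ x hx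
        rw [hbot, Ideal.mem_bot] at h0
        obtain ⟨y, hy⟩ := exists_eq_mul_of_map_eq_zero N hN h0
        exact ⟨y, trivial, hy⟩
      have hshift := upperLie_shift_pow (of_sub_one_central hcz) hmain p
      rw [eq_bot_iff]
      intro x hx
      have hle : 0 + p * (r - 1) ≤ n - 1 := by
        rw [hcardQ, Nat.mul_sub, mul_one]; omega
      obtain ⟨y, -, rfl⟩ := hshift x (upperLie_antitone hle hx)
      rw [hep, zero_mul]
      exact zero_mem _

end NonCyclic

/-! ### The alternating commutator form modulo p. -/

section CommutatorExponent

variable (F : Type*) {G : Type*} [Field F] [Group G] {p : ℕ} [CharP F p] {c : G}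

open Classical in
/-- The exponent `j` with `⁅g, h⁆ = cʲ`, as an element of `F`. -/
noncomputable def commExp (c g h : G) : F :=
  if H : ∃ j : ℕ, ⁅g, h⁆ = c ^ j then (H.choose : F) else 0

variable {F}

theorem commExp_eq (hpc : p ∣ orderOf c) {g h : G} {j : ℕ} (hj : ⁅g, h⁆ = c ^ j) :
    commExp F c g h = (j : F) := by
  have H : ∃ j : ℕ, ⁅g, h⁆ = c ^ j := ⟨j, hj⟩
  rw [commExp, dif_pos H, CharP.natCast_eq_natCast F p]
  exact (pow_eq_pow_iff_modEq.1 (H.choose_spec.symm.trans hj)).of_dvd hpc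

theorem CyclicCommutators.conj_pow_eq (hc : CyclicCommutators p c) (g : G) (j : ℕ) :
    ∃ m : ℕ, g * c ^ j * g⁻¹ = c ^ (j + p * m) := by
  obtain ⟨m, hm⟩ := hc.conj g
  exact ⟨m * j, by rw [← conj_pow, hm, ← pow_mul]; congr 1; ring⟩

/-- Conjugation alters exponents of c only by multiples of p, so the twist in ⁅g, hk⁆ disappears
modulo p. -/
theorem CyclicCommutators.commExp_mul_right (hc : CyclicCommutators p c) (hpc : p ∣ orderOf c)
    (g h k : G) : commExp F c g (h * k) = commExp F c g h + commExp F c g k := by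
  obtain ⟨i, hi⟩ := hc.comm g h
  obtain ⟨j, hj⟩ := hc.comm g k
  obtain ⟨m, hm⟩ := hc.conj_pow_eq h j
  have h1 : ⁅g, h * k⁆ = c ^ (i + (j + p * m)) := by
    rw [pow_add, ← hi, ← hm, ← hj]
    simp only [commutatorElement_def]
    group
  rw [commExp_eq hpc hi, commExp_eq hpc hj, commExp_eq hpc h1]
  simp

theorem CyclicCommutators.commExp_mul_left (hc : CyclicCommutators p c) (hpc : p ∣ orderOf c)
    (g h k : G) : commExp F c (g * h) k = commExp F c g k + commExp F c h k := by
  obtain ⟨i, hi⟩ := hc.comm g k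
  obtain ⟨j, hj⟩ := hc.comm h k
  obtain ⟨m, hm⟩ := hc.conj_pow_eq g j
  have h1 : ⁅g * h, k⁆ = c ^ ((j + p * m) + i) := by
    rw [pow_add, ← hi, ← hm, ← hj]
    simp only [commutatorElement_def]
    group
  rw [commExp_eq hpc hi, commExp_eq hpc hj, commExp_eq hpc h1]
  simp [add_comm]

theorem commExp_self (hpc : p ∣ orderOf c) (g : G) : commExp F c g g = 0 := by
  rw [commExp_eq (j := 0) hpc (by simp)]
  simp

theorem CyclicCommutators.commExp_swap (hc : CyclicCommutators p c) (hpc : p ∣ orderOf c)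
    (g h : G) : commExp F c h g = -commExp F c g h := by
  have h1 := commExp_self (F := F) hpc (g * h)
  rw [hc.commExp_mul_left hpc, hc.commExp_mul_right hpc, hc.commExp_mul_right hpc,
    commExp_self hpc, commExp_self hpc, zero_add, add_zero] at h1
  exact eq_neg_of_add_eq_zero_right h1

theorem CyclicCommutators.commExp_inv_right (hc : CyclicCommutators p c) (hpc : p ∣ orderOf c)
    (g h : G) : commExp F c g h⁻¹ = -commExp F c g h := by
  have h1 := hc.commExp_mul_right (F := F) hpc g h h⁻¹
  rw [mul_inv_cancel, commExp_eq (j := 0) hpc (by simp), Nat.cast_zero] at h1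
  exact eq_neg_of_add_eq_zero_right h1.symm

theorem CyclicCommutators.commExp_pow_right (hc : CyclicCommutators p c) (hpc : p ∣ orderOf c)
    (g h : G) (n : ℕ) : commExp F c g (h ^ n) = n * commExp F c g h := by
  induction n with
  | zero => rw [pow_zero, commExp_eq (j := 0) hpc (by simp)]; simp
  | succ n ih => rw [pow_succ, hc.commExp_mul_right hpc, ih]; push_cast; ring

theorem CyclicCommutators.commExp_generator (hc : CyclicCommutators p c) (hpc : p ∣ orderOf c)
    (g : G) : commExp F c g c = 0 := by
  obtain ⟨m, hm⟩ := hc.conj g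
  have h1 : ⁅g, c⁆ = c ^ (p * m) := by
    rw [commutatorElement_def, hm, add_comm, pow_succ, mul_inv_cancel_right]
  rw [commExp_eq hpc h1]
  simp

end CommutatorExponent

/-! ### Moments of an additive function on the group. -/

section Moments

variable {F G : Type*} [Field F] [Group G]

/-- The linear extension of a function on a group to its group algebra. -/
noncomputable def linExt (f : G → F) : MonoidAlgebra F G →ₗ[F] F where
  toFun x := x.coeff.sum fun g r => r * f g
  map_add' x y := by
    rw [MonoidAlgebra.coeff_add]
    exact Finsupp.sum_add_index' (by simp) (by intros; ring)
  map_smul' r x := by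
    rw [MonoidAlgebra.coeff_smul, Finsupp.sum_smul_index (by simp), RingHom.id_apply, smul_eq_mul,
      Finsupp.mul_sum]
    simp only [mul_assoc]

theorem linExt_of (f : G → F) (g : G) : linExt f (of F G g) = f g := by
  simp [linExt]

variable {α : G → F}

/-- The functionals given by 1, α and α² behave like value, first and second derivative at the
augmentation; this is the second-order Leibniz rule. -/
theorem linExt_mul_of_additive (hα : ∀ g h, α (g * h) = α g + α h) (x y : MonoidAlgebra F G) :
    linExt (fun g => α g ^ 2) (x * y) = linExt (fun g => α g ^ 2) x * linExt 1 y +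
      2 * linExt α x * linExt α y + linExt 1 x * linExt (fun g => α g ^ 2) y := by
  induction x using MonoidAlgebra.induction_on with
  | of g =>
    induction y using MonoidAlgebra.induction_on with
    | of h =>
      rw [← map_mul]
      simp only [linExt_of, hα, Pi.one_apply]
      ring
    | add x y hx hy => simp only [mul_add, map_add, hx, hy]; ring
    | smul r x hx => simp only [mul_smul_comm, map_smul, hx, smul_eq_mul]; ring
  | add x y hx hy => simp only [add_mul, map_add, hx, hy]; ring
  | smul r x hx => simp only [smul_mul_assoc, map_smul, hx, smul_eq_mul]; ring

theorem linExt_mul_of_additive_one (hα : ∀ g h, α (g * h) = α g + α h) (x y : MonoidAlgebra F G) :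
    linExt α (x * y) = linExt α x * linExt 1 y + linExt 1 x * linExt α y := by
  induction x using MonoidAlgebra.induction_on with
  | of g =>
    induction y using MonoidAlgebra.induction_on with
    | of h =>
      rw [← map_mul]
      simp only [linExt_of, hα, Pi.one_apply]
      ring
    | add x y hx hy => simp only [mul_add, map_add, hx, hy]; ring
    | smul r x hx => simp only [mul_smul_comm, map_smul, hx, smul_eq_mul]; ring
  | add x y hx hy => simp only [add_mul, map_add, hx, hy]; ring
  | smul r x hx => simp only [smul_mul_assoc, map_smul, hx, smul_eq_mul]; ring

theorem linExt_one_mul (x y : MonoidAlgebra F G) :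
    linExt (1 : G → F) (x * y) = linExt 1 x * linExt 1 y := by
  induction x using MonoidAlgebra.induction_on with
  | of g =>
    induction y using MonoidAlgebra.induction_on with
    | of h =>
      rw [← map_mul]
      simp only [linExt_of, Pi.one_apply]
      ring
    | add x y hx hy => simp only [mul_add, map_add, hx, hy]
    | smul r x hx => simp only [mul_smul_comm, map_smul, hx, smul_eq_mul]; ring
  | add x y hx hy => simp only [add_mul, map_add, hx, hy]
  | smul r x hx => simp only [smul_mul_assoc, map_smul, hx, smul_eq_mul]; ring

/-- A linear functional invariant under left translation by `c` vanishes on the ideal generated by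
`c - 1`. -/
theorem linExt_sub_one_mul {f : G → F} {c : G} (hf : ∀ g, f (c * g) = f g)
    (x : MonoidAlgebra F G) : linExt f ((of F G c - 1) * x) = 0 := by
  induction x using MonoidAlgebra.induction_on with
  | of g => rw [sub_mul, one_mul, ← map_mul, map_sub, linExt_of, linExt_of, hf, sub_self]
  | add x y hx hy => rw [mul_add, map_add, hx, hy, add_zero]
  | smul r x hx => rw [mul_smul_comm, map_smul, hx, smul_zero]

end Moments

/-! ### Nonvanishing of iterated Lie commutators. -/

section LowerBound

variable {F G : Type*} [Field F] [Group G] {p : ℕ} {c : G}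

open Polynomial in
theorem sub_one_pow_eq_geom_sum [Fact p.Prime] [CharP F p] {A : Type*} [Ring A] [Algebra F A]
    (n : ℕ) (x : A) : (x - 1) ^ (p ^ n - 1) = ∑ i ∈ Finset.range (p ^ n), x ^ i := by
  have h : (X - 1 : F[X]) ^ (p ^ n - 1) = ∑ i ∈ Finset.range (p ^ n), X ^ i := by
    have hX : (X - 1 : F[X]) ≠ 0 := by simpa using X_sub_C_ne_zero (1 : F)
    apply mul_right_cancel₀ hX
    rw [geom_sum_mul, ← pow_succ, Nat.sub_add_cancel (Nat.pos_of_neZero (p ^ n)),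
      sub_pow_char_pow, one_pow]
  simpa using congrArg (aeval x) h

/-- A functional invariant under translation by `c` vanishes on the annihilator of the sum of the
elements of `⟨c⟩`. -/
theorem linExt_eq_zero_of_geom_sum_mul {f : G → F} (hc : IsOfFinOrder c)
    (hf : ∀ g, f (c * g) = f g) {w : MonoidAlgebra F G}
    (hw : (∑ i ∈ Finset.range (orderOf c), of F G c ^ i) * w = 0) : linExt f w = 0 := by
  classical
  let rep : G → G := fun g =>
    (Quotient.mk (QuotientGroup.rightRel (Subgroup.zpowers c)) g).out
  have hfpow : ∀ (i : ℕ) g, f (c ^ i * g) = f g := by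
    intro i g
    induction i with
    | zero => simp
    | succ i ih => rw [pow_succ', mul_assoc, hf, ih]
  have hreppow : ∀ (i : ℕ) g, rep (c ^ i * g) = rep g := by
    intro i g
    have h : Quotient.mk (QuotientGroup.rightRel (Subgroup.zpowers c)) (c ^ i * g) =
        Quotient.mk (QuotientGroup.rightRel (Subgroup.zpowers c)) g := by
      apply Quotient.sound
      change QuotientGroup.rightRel _ _ _
      rw [QuotientGroup.rightRel_apply, mul_inv_rev, mul_inv_cancel_left]
      exact inv_mem (pow_mem (Subgroup.mem_zpowers c) i)
    simp only [rep, h]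
  have hrep : ∀ g, ∃ i < orderOf c, rep g = c ^ i * g := by
    intro g
    have h : QuotientGroup.rightRel (Subgroup.zpowers c) g (rep g) :=
      (QuotientGroup.rightRel (Subgroup.zpowers c)).symm' (Quotient.exact (Quotient.out_eq
        (Quotient.mk (QuotientGroup.rightRel (Subgroup.zpowers c)) g)))
    rw [QuotientGroup.rightRel_apply] at h
    obtain ⟨j, hj⟩ := exists_eq_pow_of_mem_zpowers hc h
    refine ⟨j % orderOf c, Nat.mod_lt _ hc.orderOf_pos, ?_⟩
    rw [pow_mod_orderOf, ← hj, inv_mul_cancel_right]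
  -- Restricting f to a transversal of the cosets ⟨c⟩g picks out exactly one term of the sum.
  have key : ∀ x : MonoidAlgebra F G,
      linExt (fun g => if g = rep g then f g else 0)
        ((∑ i ∈ Finset.range (orderOf c), of F G c ^ i) * x) = linExt f x := by
    intro x
    induction x using MonoidAlgebra.induction_on with
    | of g =>
      obtain ⟨i, hi, hig⟩ := hrep g
      rw [Finset.sum_mul, map_sum, linExt_of, Finset.sum_eq_single i]
      · rw [← map_pow, ← map_mul, linExt_of, hreppow, hig, if_pos rfl, hfpow]
      · intro j hj hji
        rw [← map_pow, ← map_mul, linExt_of, hreppow, hig, if_neg]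
        intro h
        exact hji (pow_injOn_Iio_orderOf (by simpa using hj) hi (mul_right_cancel h))
      · intro h
        exact absurd (Finset.mem_range.2 hi) h
    | add x y hx hy => rw [mul_add, map_add, hx, hy, map_add]
    | smul r x hx => rw [mul_smul_comm, map_smul, hx, map_smul]
  rw [← key, hw, map_zero]

variable [CharP F p]

/-- The geometric sum supplies a cofactor of c - 1 with j terms, and a c-invariant functional takes
the same value on each. -/
theorem CyclicCommutators.exists_commutator_of_eq (hc : CyclicCommutators p c)
    (hpc : p ∣ orderOf c) (g h : G) :
    ∃ v, of F G g * of F G h - of F G h * of F G g = (of F G c - 1) * v ∧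
      ∀ f : G → F, (∀ g, f (c * g) = f g) → linExt f v = commExp F c g h * f (h * g) := by
  obtain ⟨j, hj⟩ := hc.comm g h
  refine ⟨(∑ i ∈ Finset.range j, of F G c ^ i) * (of F G h * of F G g), ?_, fun f hf => ?_⟩
  · rw [commutator_of_of, hj, of_pow_sub_one, mul_assoc]
  · have hfpow : ∀ (i : ℕ) g, f (c ^ i * g) = f g := by
      intro i g
      induction i with
      | zero => simp
      | succ i ih => rw [pow_succ', mul_assoc, hf, ih]
    rw [commExp_eq hpc hj, Finset.sum_mul, map_sum, ← map_mul]
    simp only [← map_pow, ← map_mul, linExt_of, hfpow, Finset.sum_const, Finset.card_range,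
      nsmul_eq_mul]

variable (F) in
/-- The symmetric lift of `(a - a⁻¹)(b - b⁻¹)`. -/
noncomputable def hyperbolic (a b : G) : MonoidAlgebra F G :=
  of F G (a * b) + of F G (a * b)⁻¹ - (of F G (a * b⁻¹) + of F G (a * b⁻¹)⁻¹)

variable {a b : G}

theorem CyclicCommutators.commExp_generator_mul (hc : CyclicCommutators p c)
    (hpc : p ∣ orderOf c) (g : G) : commExp F c a (c * g) = commExp F c a g := by
  rw [hc.commExp_mul_right hpc, hc.commExp_generator hpc, zero_add]

/-- For w = g put t = α(g) and s the exponent of ⁅g, b⁆. The four terms sum to 4t(s - t) - 4t(s + t)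
= -8t², so s drops out and the second moment is an eigenfunctional. -/
theorem CyclicCommutators.exists_commutator_hyperbolic_eq (hc : CyclicCommutators p c)
    (hpc : p ∣ orderOf c) (hab : commExp F c a b = 1) (w : MonoidAlgebra F G) :
    ∃ v, w * hyperbolic F a b - hyperbolic F a b * w = (of F G c - 1) * v ∧
      linExt (fun g => commExp F c a g ^ 2) v = -8 * linExt (fun g => commExp F c a g ^ 2) w ∧
      linExt (1 : G → F) v = 0 := by
  induction w using MonoidAlgebra.induction_on with
  | of g =>
    obtain ⟨v₁, h₁, f₁⟩ := hc.exists_commutator_of_eq (F := F) hpc g (a * b)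
    obtain ⟨v₂, h₂, f₂⟩ := hc.exists_commutator_of_eq (F := F) hpc g (a * b)⁻¹
    obtain ⟨v₃, h₃, f₃⟩ := hc.exists_commutator_of_eq (F := F) hpc g (a * b⁻¹)
    obtain ⟨v₄, h₄, f₄⟩ := hc.exists_commutator_of_eq (F := F) hpc g (a * b⁻¹)⁻¹
    refine ⟨v₁ + v₂ - (v₃ + v₄), ?_, ?_, ?_⟩
    · rw [mul_sub, mul_add, mul_add, ← h₁, ← h₂, ← h₃, ← h₄, hyperbolic]
      noncomm_ring
    · have hinv : ∀ g, (fun g => commExp F c a g ^ 2) (c * g) =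
          (fun g => commExp F c a g ^ 2) g := fun g => by
        simp only [hc.commExp_generator_mul hpc]
      rw [map_sub, map_add, map_add, f₁ _ hinv, f₂ _ hinv, f₃ _ hinv, f₄ _ hinv, linExt_of]
      simp only [hc.commExp_mul_right hpc, hc.commExp_inv_right hpc, commExp_self hpc, hab,
        hc.commExp_swap hpc a g]
      ring
    · rw [map_sub, map_add, map_add, f₁ 1 (fun _ => rfl), f₂ 1 (fun _ => rfl),
        f₃ 1 (fun _ => rfl), f₄ 1 (fun _ => rfl)]
      simp only [hc.commExp_inv_right hpc, Pi.one_apply]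
      ring
  | add x y hx hy =>
    obtain ⟨u, h₁, h₂, h₃⟩ := hx
    obtain ⟨v, h₄, h₅, h₆⟩ := hy
    refine ⟨u + v, ?_, ?_, ?_⟩
    · rw [mul_add _ u, ← h₁, ← h₄]; noncomm_ring
    · rw [map_add, map_add, h₂, h₅]; ring
    · rw [map_add, h₃, h₆, add_zero]
  | smul r x hx =>
    obtain ⟨u, h₁, h₂, h₃⟩ := hx
    refine ⟨r • u, ?_, ?_, ?_⟩
    · rw [mul_smul_comm _ _ u, ← h₁, mul_smul_comm, smul_mul_assoc, smul_sub]
    · rw [map_smul, map_smul, h₂, smul_eq_mul, smul_eq_mul]; ring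
    · rw [map_smul, h₃, smul_zero]

variable [Fact p.Prime]

theorem CyclicCommutators.exists_commutator_pow_mul_hyperbolic_eq (hc : CyclicCommutators p c)
    (hp : Odd p) (hpc : p ∣ orderOf c) (hab : commExp F c a b = 1) (k : ℕ)
    (w : MonoidAlgebra F G) :
    ∃ v, (of F G c - 1) ^ k * w * hyperbolic F a b -
        hyperbolic F a b * ((of F G c - 1) ^ k * w) = (of F G c - 1) ^ (k + 1) * v ∧
      linExt (fun g => commExp F c a g ^ 2) v = -8 * linExt (fun g => commExp F c a g ^ 2) w ∧
      linExt (1 : G → F) v = 0 := by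
  obtain ⟨z, hz⟩ := hc.exists_commutator_pow_mul_eq hp k w (hyperbolic F a b)
  obtain ⟨v, h₁, h₂, h₃⟩ := hc.exists_commutator_hyperbolic_eq hpc hab w
  refine ⟨v + (of F G c - 1) * z, ?_, ?_, ?_⟩
  · rw [hz, h₁, mul_add, ← mul_assoc, ← mul_assoc, ← pow_succ, ← pow_succ]
  · rw [map_add, linExt_sub_one_mul (fun g => by rw [hc.commExp_generator_mul hpc]), add_zero, h₂]
  · rw [map_add, linExt_sub_one_mul (fun g => rfl), add_zero, h₃]

theorem CyclicCommutators.exists_mem_lieLowerSeries (hc : CyclicCommutators p c)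
    (hp : Odd p) (hpc : p ∣ orderOf c) (hab : commExp F c a b = 1) {S : Set (MonoidAlgebra F G)}
    (hx : of F G b + of F G b⁻¹ ∈ S) (hy : hyperbolic F a b ∈ S) (k : ℕ) :
    ∃ w, (of F G c - 1) ^ k * w ∈ lieLowerSeries S k ∧
      linExt (fun g => commExp F c a g ^ 2) w = (-8) ^ k * 2 := by
  induction k with
  | zero =>
    refine ⟨of F G b + of F G b⁻¹, by simpa [lieLowerSeries] using hx, ?_⟩
    rw [map_add, linExt_of, linExt_of, hc.commExp_inv_right hpc, hab]
    ring
  | succ k ih =>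
    obtain ⟨w, hw, hw'⟩ := ih
    obtain ⟨v, h₁, h₂, -⟩ := hc.exists_commutator_pow_mul_hyperbolic_eq hp hpc hab k w
    refine ⟨v, ?_, by rw [h₂, hw']; ring⟩
    rw [← h₁]
    exact commutator_mem_lieLowerSeries hw hy

theorem two_ne_zero_of_odd_char (hp : Odd p) : (2 : F) ≠ 0 := by
  have : ((2 : ℕ) : F) ≠ 0 := by
    rw [Ne, CharP.cast_eq_zero_iff F p]
    intro h
    have h3 := (Nat.prime_dvd_prime_iff_eq (Fact.out : p.Prime) Nat.prime_two).1 h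
    subst h3
    exact absurd hp (by decide)
  simpa using this

theorem CyclicCommutators.pow_mul_ne_zero (hc : CyclicCommutators p c) (hp : Odd p) {n : ℕ}
    (hn : orderOf c = p ^ n) (hpc : p ∣ orderOf c) (k : ℕ) {w : MonoidAlgebra F G}
    (hw : linExt (fun g => commExp F c a g ^ 2) w = (-8) ^ k * 2) :
    (of F G c - 1) ^ (p ^ n - 1) * w ≠ 0 := by
  intro h0
  have h2 : (2 : F) ≠ 0 := two_ne_zero_of_odd_char hp
  have hfin : IsOfFinOrder c := by
    rw [← orderOf_pos_iff, hn]
    exact pow_pos (Fact.out : p.Prime).pos n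
  rw [sub_one_pow_eq_geom_sum (F := F), ← hn] at h0
  have h3 := linExt_eq_zero_of_geom_sum_mul (f := fun g => commExp F c a g ^ 2) hfin
    (fun g => by rw [hc.commExp_generator_mul hpc]) h0
  rw [hw, show (-8 : F) = -(2 ^ 3) by norm_num] at h3
  simp [h2] at h3

end LowerBound

/-! ### Nonvanishing of iterated group commutators of units. -/

section Units

variable {F G : Type*} [Field F] [Group G] {p : ℕ} {c : G}

section Tangent

variable {α : G → F}

theorem linExt_one_units_inv {u : (MonoidAlgebra F G)ˣ} (h : linExt (1 : G → F) u = 1) :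
    linExt (1 : G → F) ((u⁻¹ : (MonoidAlgebra F G)ˣ) : MonoidAlgebra F G) = 1 := by
  have h1 := linExt_one_mul (u : MonoidAlgebra F G) ((u⁻¹ : (MonoidAlgebra F G)ˣ) : MonoidAlgebra F G)
  rw [Units.mul_inv, h, one_mul, ← map_one (of F G), linExt_of] at h1
  exact h1.symm

theorem linExt_units_inv (hα : ∀ g h, α (g * h) = α g + α h) {u : (MonoidAlgebra F G)ˣ}
    (h : linExt (1 : G → F) u = 1) (h' : linExt α (u : MonoidAlgebra F G) = 0) :
    linExt α ((u⁻¹ : (MonoidAlgebra F G)ˣ) : MonoidAlgebra F G) = 0 := by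
  have h1 := linExt_mul_of_additive_one hα (u : MonoidAlgebra F G)
    ((u⁻¹ : (MonoidAlgebra F G)ˣ) : MonoidAlgebra F G)
  have h2 : α 1 = 0 := by simpa using hα 1 1
  rw [Units.mul_inv, h, h', zero_mul, zero_add, one_mul, ← map_one (of F G), linExt_of, h2] at h1
  exact h1.symm

end Tangent

theorem isUnit_of_isNilpotent_sub_one {A : Type*} [Ring A] {x : A} (h : IsNilpotent (x - 1)) :
    IsUnit x := by
  simpa using h.isUnit_one_add

variable [CharP F p] {a b : G} [Fact p.Prime]

/-- A group commutator differs from a Lie one by a unit factor s. Keeping augmentation 1 and first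
moment 0 along the induction ensures, by the Leibniz rule, that s leaves the second moment
unchanged. -/
theorem CyclicCommutators.exists_mem_groupLowerSeries (hc : CyclicCommutators p c)
    (hp : Odd p) (hpc : p ∣ orderOf c) (hab : commExp F c a b = 1)
    {H : Set (MonoidAlgebra F G)ˣ} {u v : (MonoidAlgebra F G)ˣ} (hu : u ∈ H) (hv : v ∈ H)
    (hu' : (u : MonoidAlgebra F G) = of F G b + of F G b⁻¹ - 1)
    (hv' : (v : MonoidAlgebra F G) = 1 + hyperbolic F a b) (k : ℕ) :
    ∃ g ∈ groupLowerSeries H k, linExt (1 : G → F) g = 1 ∧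
      linExt (commExp F c a) (g : MonoidAlgebra F G) = 0 ∧
      ∃ w, (g : MonoidAlgebra F G) - 1 = (of F G c - 1) ^ k * w ∧
        linExt (fun g => commExp F c a g ^ 2) w = (-8) ^ k * 2 := by
  have hα := fun g h => hc.commExp_mul_right (F := F) hpc a g h
  have ha1 : commExp F c a 1 = 0 := by simpa using hα 1 1
  have hone : ∀ f : G → F, linExt f (1 : MonoidAlgebra F G) = f 1 := fun f => by
    rw [← map_one (of F G), linExt_of]
  have hv1 : linExt (1 : G → F) (v : MonoidAlgebra F G) = 1 := by
    simp only [hv', hyperbolic, map_add, map_sub, hone, linExt_of, Pi.one_apply]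
    ring
  have hvα : linExt (commExp F c a) (v : MonoidAlgebra F G) = 0 := by
    simp only [hv', hyperbolic, map_add, map_sub, hone, linExt_of, ha1, hα,
      hc.commExp_inv_right hpc]
    ring
  induction k with
  | zero =>
    refine ⟨u, hu, ?_, ?_, of F G b + of F G b⁻¹ - 2, ?_, ?_⟩
    · simp only [hu', map_add, map_sub, hone, linExt_of, Pi.one_apply]
      ring
    · simp only [hu', map_add, map_sub, hone, linExt_of, ha1, hc.commExp_inv_right hpc]
      ring
    · rw [hu', pow_zero, one_mul]
      norm_num [sub_sub]
    · have h2 : (2 : MonoidAlgebra F G) = 1 + 1 := by norm_num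
      simp only [h2, map_add, map_sub, hone, linExt_of, ha1, hc.commExp_inv_right hpc, hab]
      ring
  | succ k ih =>
    obtain ⟨g, hg, hg1, hgα, w, hgw, hw⟩ := ih
    obtain ⟨x, h₁, h₂, h₃⟩ := hc.exists_commutator_pow_mul_hyperbolic_eq hp hpc hab k w
    set s : MonoidAlgebra F G := ((g⁻¹ * v⁻¹ : (MonoidAlgebra F G)ˣ) : MonoidAlgebra F G) with hs
    have hs1 : linExt (1 : G → F) s = 1 := by
      rw [hs, Units.val_mul, linExt_one_mul, linExt_one_units_inv hg1, linExt_one_units_inv hv1,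
        mul_one]
    have hsα : linExt (commExp F c a) s = 0 := by
      rw [hs, Units.val_mul, linExt_mul_of_additive_one hα, linExt_units_inv hα hg1 hgα,
        linExt_units_inv hα hv1 hvα]
      ring
    refine ⟨g⁻¹ * v⁻¹ * g * v, commutator_mem_groupLowerSeries hg hv, ?_, ?_, ?_⟩
    · rw [Units.val_mul, Units.val_mul, ← hs, linExt_one_mul, linExt_one_mul, hs1, hg1, hv1]
      ring
    · rw [Units.val_mul, Units.val_mul, ← hs, linExt_mul_of_additive_one hα,
        linExt_mul_of_additive_one hα, hsα, hgα, hvα]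
      ring
    · obtain ⟨t, ht⟩ := hc.exists_commutator_pow_eq hp (k + 1) s
      refine ⟨s * x - (of F G c - 1) * ((of F G c - 1) * (t * x)), ?_, ?_⟩
      · have h4 : (((g⁻¹ * v⁻¹ * g * v : (MonoidAlgebra F G)ˣ)) : MonoidAlgebra F G) - 1 =
            s * (((g : MonoidAlgebra F G) - 1) * hyperbolic F a b -
              hyperbolic F a b * ((g : MonoidAlgebra F G) - 1)) := by
          have h5 : s * (v * g) = 1 := by
            rw [hs, ← Units.val_mul, ← Units.val_mul, Units.val_eq_one]; group
          have h6 : ((g : MonoidAlgebra F G) - 1) * hyperbolic F a b -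
              hyperbolic F a b * ((g : MonoidAlgebra F G) - 1) = g * v - v * g := by
            rw [hv']; noncomm_ring
          rw [h6, mul_sub, h5, hs]
          simp only [Units.val_mul, mul_assoc]
        have h7 : s * (of F G c - 1) ^ (k + 1) = (of F G c - 1) ^ (k + 1) * s -
            (of F G c - 1) ^ (k + 1) * ((of F G c - 1) * ((of F G c - 1) * t)) := by
          rw [← mul_assoc, ← mul_assoc, ← pow_succ, ← pow_succ, ← ht]
          abel
        rw [h4, hgw, h₁, ← mul_assoc, h7]
        noncomm_ring
      · rw [map_sub, linExt_sub_one_mul (fun g => by rw [hc.commExp_generator_mul hpc]), sub_zero,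
          linExt_mul_of_additive hα, h₃, hsα, hs1, h₂, hw]
        ring

theorem isUnit_of_add_of_inv_sub_one {s : ℕ} (hb : b ^ p ^ s = 1) :
    IsUnit (of F G b + of F G b⁻¹ - 1) := by
  apply isUnit_of_isNilpotent_sub_one
  have h : of F G b + of F G b⁻¹ - 1 - 1 = (of F G b - 1) * (1 - of F G b⁻¹) := by
    rw [sub_mul, mul_sub, of_mul_of_inv]; noncomm_ring
  have hcomm : Commute (of F G b - 1) (1 - of F G b⁻¹) := by
    have h1 : Commute (of F G b) (of F G b⁻¹) := ((Commute.refl b).inv_right).map (of F G)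
    exact ((Commute.one_right _).sub_right h1).sub_left (Commute.one_left _)
  rw [h]
  refine hcomm.isNilpotent_mul_right ⟨p ^ s, ?_⟩
  rw [of_sub_one_pow_prime_pow, hb, map_one, sub_self]

/-- Over the abelianization the p ^ s-th power of (a - a⁻¹)(b - b⁻¹) vanishes, so that power of the
lift lies in the nilpotent ideal generated by c - 1. -/
theorem isUnit_one_add_hyperbolic {s n : ℕ} (hb : b ^ p ^ s = 1) (hc : CyclicCommutators p c)
    (hn : orderOf c = p ^ n) (hN : ∀ g ∈ commutator G, ∃ j : ℕ, g = c ^ j) :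
    IsUnit (1 + hyperbolic F a b) := by
  apply isUnit_of_isNilpotent_sub_one
  rw [add_sub_cancel_left]
  let π : MonoidAlgebra F G →+* MonoidAlgebra F (Abelianization G) :=
    MonoidAlgebra.mapDomainRingHom F Abelianization.of
  have hπ : π (hyperbolic F a b) ^ p ^ s = 0 := by
    have h1 : ∀ g, π (of F G g) = of F _ (Abelianization.of g) := fun g => by simp [π]
    have h2 : π (hyperbolic F a b) =
        (of F _ (Abelianization.of a) - of F _ (Abelianization.of a)⁻¹) *
          (of F _ (Abelianization.of b) - of F _ (Abelianization.of b)⁻¹) := by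
      simp only [hyperbolic, map_sub, map_add, h1, map_mul, map_inv, mul_inv, inv_inv]
      ring
    have h3 : (Abelianization.of b) ^ p ^ s = 1 := by rw [← map_pow, hb, map_one]
    have h4 : of F _ (Abelianization.of b) ^ p ^ s = 1 := by rw [← map_pow, h3, map_one]
    have h5 : of F _ (Abelianization.of b)⁻¹ ^ p ^ s = 1 := by
      rw [← map_pow, inv_pow, h3, inv_one, map_one]
    rw [h2, mul_pow, sub_pow_char_pow (of F _ (Abelianization.of b)), h4, h5, sub_self, mul_zero]
  obtain ⟨y, hy⟩ := exists_eq_mul_of_map_eq_zero (F := F) (commutator G) hN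
    (x := hyperbolic F a b ^ p ^ s) (by rw [← map_pow] at hπ; exact hπ)
  have hpow : ∀ m, ∃ z, ((of F G c - 1) * y) ^ m = (of F G c - 1) ^ m * z := by
    intro m
    induction m with
    | zero => exact ⟨1, by simp⟩
    | succ m ih =>
      obtain ⟨z, hz⟩ := ih
      obtain ⟨t, ht⟩ := hc.exists_mul_eq z
      exact ⟨t * y, by rw [pow_succ, hz, pow_succ, mul_assoc, ← mul_assoc z, ht]; noncomm_ring⟩
  obtain ⟨z, hz⟩ := hpow (p ^ n)
  refine ⟨p ^ s * p ^ n, ?_⟩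
  rw [pow_mul, hy, hz, of_sub_one_pow_prime_pow, ← hn, pow_orderOf_eq_one, map_one, sub_self,
    zero_mul]

end Units

/-! ### Symmetric elements. -/

section Symmetric

variable {F G : Type*} [Field F] [Group G]

theorem orientedInvolution_add (σ : G →* ℤˣ) (x y : MonoidAlgebra F G) :
    orientedInvolution σ (x + y) = orientedInvolution σ x + orientedInvolution σ y := by
  rw [orientedInvolution, MonoidAlgebra.coeff_add]
  exact Finsupp.sum_add_index' (by simp) (by intros; rw [add_mul, MonoidAlgebra.single_add])

theorem orientedInvolution_of {σ : G →* ℤˣ} {g : G} (hg : σ g = 1) :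
    orientedInvolution σ (of F G g) = of F G g⁻¹ := by
  simp [orientedInvolution, hg]

theorem add_mem_symmetricElements {σ : G →* ℤˣ} {x y : MonoidAlgebra F G}
    (hx : x ∈ symmetricElements F σ) (hy : y ∈ symmetricElements F σ) :
    x + y ∈ symmetricElements F σ := by
  rw [symmetricElements, Set.mem_ofPred_eq] at *
  rw [orientedInvolution_add, hx, hy]

theorem neg_mem_symmetricElements {σ : G →* ℤˣ} {x : MonoidAlgebra F G}
    (hx : x ∈ symmetricElements F σ) : -x ∈ symmetricElements F σ := by
  rw [symmetricElements, Set.mem_ofPred_eq] at *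
  have h0 : orientedInvolution σ (0 : MonoidAlgebra F G) = 0 := by simp [orientedInvolution]
  have h := orientedInvolution_add σ x (-x)
  rw [add_neg_cancel, h0, hx] at h
  exact eq_neg_of_add_eq_zero_right h.symm

theorem one_mem_symmetricElements (σ : G →* ℤˣ) :
    (1 : MonoidAlgebra F G) ∈ symmetricElements F σ := by
  rw [symmetricElements, Set.mem_ofPred_eq, ← map_one (of F G), orientedInvolution_of (map_one σ),
    inv_one]

theorem of_add_of_inv_mem_symmetricElements {σ : G →* ℤˣ} {g : G} (hg : σ g = 1) :
    of F G g + of F G g⁻¹ ∈ symmetricElements F σ := by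
  rw [symmetricElements, Set.mem_ofPred_eq, orientedInvolution_add, orientedInvolution_of hg,
    orientedInvolution_of (by rw [map_inv, hg, inv_one]), inv_inv, add_comm]

theorem hyperbolic_mem_symmetricElements {σ : G →* ℤˣ} {a b : G} (ha : σ a = 1) (hb : σ b = 1) :
    hyperbolic F a b ∈ symmetricElements F σ := by
  rw [hyperbolic, sub_eq_add_neg]
  refine add_mem_symmetricElements (of_add_of_inv_mem_symmetricElements ?_)
    (neg_mem_symmetricElements (of_add_of_inv_mem_symmetricElements ?_)) <;> simp [ha, hb]

end Symmetric

/-! ### Choice of a and b. -/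

section Generators

variable {G : Type*} [Group G] {p : ℕ} [Fact p.Prime]

/-- A cyclic commutator subgroup is generated by a commutator of two elements on which a given
orientation is trivial. -/
theorem exists_commutator_generator [Finite (commutator G)] [Nontrivial (commutator G)]
    (hp : Odd p) (hP : IsPGroup p (commutator G))
    (hZ : ∀ g : G, ∃ k, g ^ p ^ k ∈ Subgroup.center G) (hcyc : IsCyclic (commutator G))
    (σ : G →* ℤˣ) :
    ∃ a b c : G, commutator G = Subgroup.zpowers c ∧ ⁅a, b⁆ = c ∧ σ a = 1 ∧ σ b = 1 ∧
      (IsMulTorsion G → ∃ s, b ^ p ^ s = 1) := by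
  have hprime := (Fact.out : p.Prime)
  obtain ⟨c, hc⟩ := Subgroup.isCyclic_iff_exists_zpowers_eq_top (commutator G) |>.1 hcyc
  have hcc := cyclicCommutators_of_eq_zpowers hP hZ hc.symm
  have hcard : Nat.card (commutator G) = orderOf c := by rw [← hc, Nat.card_zpowers]
  obtain ⟨n, hn⟩ := IsPGroup.iff_card.1 hP
  rw [hcard] at hn
  have hpc : p ∣ orderOf c := by
    rw [← hcard]
    exact hP.card_eq_or_dvd.resolve_left Finite.one_lt_card.ne'
  have hpos : 0 < orderOf c := by rw [hn]; exact pow_pos hprime.pos n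
  -- If all exponents vanished modulo p, then G' would lie in the proper subgroup ⟨c ^ p⟩.
  obtain ⟨g, h, hgh⟩ : ∃ g h, commExp (ZMod p) c g h ≠ 0 := by
    by_contra! hall
    have hle : commutator G ≤ Subgroup.zpowers (c ^ p) := by
      rw [commutator_eq_closure, Subgroup.closure_le]
      rintro _ ⟨g, h, rfl⟩
      obtain ⟨j, hj⟩ := hcc.comm g h
      have h0 := hall g h
      rw [commExp_eq hpc hj, CharP.cast_eq_zero_iff (ZMod p) p] at h0
      obtain ⟨i, rfl⟩ := h0
      rw [hj, pow_mul]
      exact pow_mem (Subgroup.mem_zpowers _) i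
    have hfin : Finite (Subgroup.zpowers (c ^ p)) :=
      ((orderOf_pos_iff.1 hpos).pow).finite_zpowers
    have hle' := Subgroup.card_le_of_le hle
    rw [hcard, Nat.card_zpowers, orderOf_pow_of_dvd hprime.ne_zero hpc] at hle'
    exact absurd hle' (not_le.2 (Nat.div_lt_self hpos hprime.one_lt))
  -- In the torsion case t is the p'-part of the order of h, so h ^ t is a p-element.
  obtain ⟨t, ht, htors⟩ : ∃ t, ¬ p ∣ t ∧ (IsMulTorsion G → ∃ s, (h ^ t) ^ p ^ s = 1) := by
    by_cases htor : IsMulTorsion G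
    · have hpos : orderOf h ≠ 0 := (htor h).orderOf_pos.ne'
      obtain ⟨s, t, ht, hst⟩ := Nat.exists_eq_pow_mul_and_not_dvd hpos p hprime.ne_one
      exact ⟨t, ht, fun _ => ⟨s, by rw [← pow_mul, mul_comm, ← hst, pow_orderOf_eq_one]⟩⟩
    · exact ⟨1, hprime.not_dvd_one, fun h => absurd h htor⟩
  -- Squares lie in the kernel of σ; the exponent is multiplied by 4t, which is prime to p.
  obtain ⟨j, hj⟩ := hcc.comm (g ^ 2) ((h ^ t) ^ 2)
  have h2 : ¬ p ∣ 2 := fun h => by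
    rw [Nat.prime_dvd_prime_iff_eq hprime Nat.prime_two] at h
    subst h
    exact absurd hp (by decide)
  have hjp : ¬ p ∣ j := by
    rw [← CharP.cast_eq_zero_iff (ZMod p) p, ← commExp_eq hpc hj, hcc.commExp_pow_right hpc,
      hcc.commExp_pow_right hpc, hcc.commExp_swap hpc, hcc.commExp_pow_right hpc,
      hcc.commExp_swap hpc]
    rw [← CharP.cast_eq_zero_iff (ZMod p) p] at h2 ht
    simp only [mul_neg, neg_neg, mul_eq_zero, not_or]
    exact ⟨h2, ht, h2, hgh⟩
  have hcop : (orderOf c).Coprime j := by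
    rw [hn]
    exact Nat.Coprime.pow_left n ((Nat.Prime.coprime_iff_not_dvd hprime).2 hjp)
  refine ⟨g ^ 2, (h ^ t) ^ 2, c ^ j, ?_, hj, ?_, ?_, fun htor => ?_⟩
  · have hle : Subgroup.zpowers (c ^ j) ≤ commutator G := by
      rw [← hc, Subgroup.zpowers_le]
      exact pow_mem (Subgroup.mem_zpowers c) j
    refine (Subgroup.eq_of_le_of_card_ge hle ?_).symm
    rw [hcard, Nat.card_zpowers, Nat.Coprime.orderOf_pow hcop]
  · rw [map_pow, Int.units_sq]
  · rw [map_pow, Int.units_sq]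
  · obtain ⟨s, hs⟩ := htors htor
    exact ⟨s, by rw [← pow_mul, mul_comm, pow_mul, hs, one_pow]⟩

end Generators

/-! ### The bounds are attained when G' is cyclic. -/

section Attained

variable {F G : Type*} [Field F] [Group G] {p : ℕ} [Fact p.Prime] [CharP F p]

theorem lieLowerSeries_symmetricElements_ne_zero [Finite (commutator G)] (hp : Odd p)
    (hP : IsPGroup p (commutator G)) (hZ : ∀ g : G, ∃ k, g ^ p ^ k ∈ Subgroup.center G)
    (hcyc : IsCyclic (commutator G)) (σ : G →* ℤˣ) :
    lieLowerSeries (symmetricElements F σ) (Nat.card (commutator G) - 1) ≠ {0} := by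
  cases subsingleton_or_nontrivial (commutator G) with
  | inl h =>
    rw [Nat.card_of_subsingleton (1 : commutator G)]
    intro h0
    have h1 := one_mem_symmetricElements (F := F) σ
    rw [show symmetricElements F σ = {0} from h0] at h1
    exact one_ne_zero h1
  | inr h =>
    obtain ⟨a, b, c, hc, hab, ha, hb, -⟩ := exists_commutator_generator hp hP hZ hcyc σ
    have hcc := cyclicCommutators_of_eq_zpowers hP hZ hc
    have hcard : Nat.card (commutator G) = orderOf c := by rw [hc, Nat.card_zpowers]
    obtain ⟨n, hn⟩ := IsPGroup.iff_card.1 hP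
    have hpc : p ∣ orderOf c := by
      rw [← hcard]
      exact hP.card_eq_or_dvd.resolve_left Finite.one_lt_card.ne'
    have hab1 : commExp F c a b = 1 := by
      rw [commExp_eq (j := 1) hpc (by rw [hab, pow_one]), Nat.cast_one]
    obtain ⟨w, hw, hw'⟩ := hcc.exists_mem_lieLowerSeries (F := F) hp hpc hab1
      (of_add_of_inv_mem_symmetricElements hb) (hyperbolic_mem_symmetricElements ha hb) (p ^ n - 1)
    rw [hn]
    intro h0
    rw [h0, Set.mem_singleton_iff] at hw
    exact hcc.pow_mul_ne_zero hp (hcard.symm.trans hn) hpc _ hw' hw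

theorem groupLowerSeries_symmetricUnits_ne_one [Finite (commutator G)] (hp : Odd p)
    (hP : IsPGroup p (commutator G)) (hZ : ∀ g : G, ∃ k, g ^ p ^ k ∈ Subgroup.center G)
    (hcyc : IsCyclic (commutator G)) (σ : G →* ℤˣ) (htor : IsMulTorsion G) :
    groupLowerSeries (symmetricUnits F σ) (Nat.card (commutator G) - 1) ≠ {1} := by
  cases subsingleton_or_nontrivial (commutator G) with
  | inl h =>
    rw [Nat.card_of_subsingleton (1 : commutator G)]
    intro h0
    -- For trivial G' the term in question is the set of symmetric units itself, which contains -1 ≠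
    -- 1.
    have h1 : (-1 : (MonoidAlgebra F G)ˣ) ∈ symmetricUnits F σ := by
      rw [symmetricUnits, Set.mem_ofPred_eq, Units.val_neg, Units.val_one]
      exact neg_mem_symmetricElements (one_mem_symmetricElements σ)
    rw [show symmetricUnits F σ = {1} from h0, Set.mem_singleton_iff] at h1
    have h2 := congrArg (fun u : (MonoidAlgebra F G)ˣ => linExt (1 : G → F) u) h1
    simp only [Units.val_neg, Units.val_one, map_neg] at h2
    rw [← map_one (of F G), linExt_of, Pi.one_apply] at h2
    apply two_ne_zero_of_odd_char (F := F) hp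
    linear_combination -h2
  | inr h =>
    obtain ⟨a, b, c, hc, hab, ha, hb, hbs⟩ := exists_commutator_generator hp hP hZ hcyc σ
    obtain ⟨s, hs⟩ := hbs htor
    have hcc := cyclicCommutators_of_eq_zpowers hP hZ hc
    have hcard : Nat.card (commutator G) = orderOf c := by rw [hc, Nat.card_zpowers]
    obtain ⟨n, hn⟩ := IsPGroup.iff_card.1 hP
    have hcn : orderOf c = p ^ n := hcard.symm.trans hn
    have hfin : IsOfFinOrder c := by
      rw [← orderOf_pos_iff, hcn]
      exact pow_pos (Fact.out : p.Prime).pos n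
    have hpc : p ∣ orderOf c := by
      rw [← hcard]
      exact hP.card_eq_or_dvd.resolve_left Finite.one_lt_card.ne'
    have hab1 : commExp F c a b = 1 := by
      rw [commExp_eq (j := 1) hpc (by rw [hab, pow_one]), Nat.cast_one]
    obtain ⟨u, hu⟩ := isUnit_of_add_of_inv_sub_one (F := F) hs
    obtain ⟨v, hv⟩ := isUnit_one_add_hyperbolic (F := F) (a := a) hs hcc hcn
      (fun g hg => exists_eq_pow_of_mem_zpowers hfin (hc ▸ hg))
    have hus : u ∈ symmetricUnits F σ := by
      rw [symmetricUnits, Set.mem_ofPred_eq, hu, sub_eq_add_neg]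
      exact add_mem_symmetricElements (of_add_of_inv_mem_symmetricElements hb)
        (neg_mem_symmetricElements (one_mem_symmetricElements σ))
    have hvs : v ∈ symmetricUnits F σ := by
      rw [symmetricUnits, Set.mem_ofPred_eq, hv]
      exact add_mem_symmetricElements (one_mem_symmetricElements σ)
        (hyperbolic_mem_symmetricElements ha hb)
    obtain ⟨g, hg, -, -, w, hw, hw'⟩ :=
      hcc.exists_mem_groupLowerSeries hp hpc hab1 hus hvs hu hv (p ^ n - 1)
    rw [hn]
    intro h0
    rw [h0, Set.mem_singleton_iff] at hg
    rw [hg, Units.val_one, sub_self] at hw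
    exact hcc.pow_mul_ne_zero hp hcn hpc _ hw' hw.symm

end Attained

end OrientedGroupAlgebra

/-! ### The theorem. -/

theorem mainTheorem3 {F G : Type*} [Field F] [Group G] (p : ℕ) [CharP F p] (hp : Odd p)
    (σ : G →* ℤˣ) (hσ : σ ≠ 1)
    (hFG : OrientedGroupAlgebra.IsLieNilpotent (Set.univ : Set (MonoidAlgebra F G))) :
    (OrientedGroupAlgebra.lieNilpotencyIndex (OrientedGroupAlgebra.symmetricElements F σ) =
        ((Nat.card (commutator G) + 1 : ℕ) : ℕ∞) ↔ IsCyclic (commutator G)) ∧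
    (IsMulTorsion G →
      (OrientedGroupAlgebra.nilpotencyClass (OrientedGroupAlgebra.symmetricUnits F σ) =
        ((Nat.card (commutator G) : ℕ) : ℕ∞) ↔ IsCyclic (commutator G))) := by
  open OrientedGroupAlgebra in
  have hprime : Fact p.Prime :=
    ⟨(CharP.char_is_prime_or_zero F p).resolve_right (fun h => by simp [h] at hp)⟩
  have hfin := finite_commutatorSet_of_isLieNilpotent hFG
  have hfin' : Finite (commutator G) := inferInstance
  have hZ := exists_pow_mem_center_of_isLieNilpotent p hFG
  have hP := isPGroup_commutator p hZ
  have hpos : 1 ≤ Nat.card (commutator G) := Nat.card_pos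
  have hnoncyc : ¬ IsCyclic (commutator G) → 2 ≤ Nat.card (commutator G) ∧
      upperLie (MonoidAlgebra F G) (Nat.card (commutator G) - 1) = ⊥ := fun h => by
    refine ⟨?_, upperLie_eq_bot_of_not_isCyclic hp _ G hP hZ h rfl⟩
    by_contra hlt
    have : Subsingleton (commutator G) := Finite.card_le_one_iff_subsingleton.1 (by omega)
    exact h isCyclic_of_subsingleton
  have hbot : upperLie (MonoidAlgebra F G) (Nat.card (commutator G)) = ⊥ := by
    by_cases h : IsCyclic (commutator G)
    · exact upperLie_card_eq_bot_of_isCyclic hp hP hZ h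
    · rw [eq_bot_iff, ← (hnoncyc h).2]
      exact upperLie_antitone (Nat.sub_le _ _)
  obtain ⟨m, hm⟩ := Nat.exists_eq_succ_of_ne_zero (Nat.one_le_iff_ne_zero.1 hpos)
  constructor
  · rw [lieNilpotencyIndex_eq_iff hpos (by
      rw [hm] at hbot ⊢; exact lieLowerSeries_eq_zero_of_upperLie _ hbot)]
    refine ⟨fun h => ?_, fun h => lieLowerSeries_symmetricElements_ne_zero hp hP hZ h σ⟩
    by_contra hc
    obtain ⟨h2, h3⟩ := hnoncyc hc
    -- Since |G'| ≥ 2, the index |G'| - 1 is a successor, as vanishing of the series requires.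
    obtain ⟨k, hk⟩ := Nat.exists_eq_add_of_le' (Nat.le_sub_one_of_lt h2)
    rw [hk] at h h3
    exact h (lieLowerSeries_eq_zero_of_upperLie _ h3)
  · intro htor
    rw [nilpotencyClass_eq_iff hpos (by
      rw [hm] at hbot ⊢; exact groupLowerSeries_eq_one_of_upperLie _ hbot)]
    refine ⟨fun h => ?_, fun h => groupLowerSeries_symmetricUnits_ne_one hp hP hZ h σ htor⟩
    by_contra hc
    obtain ⟨h2, h3⟩ := hnoncyc hc
    obtain ⟨k, hk⟩ := Nat.exists_eq_add_of_le' (Nat.le_sub_one_of_lt h2)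
    rw [hk] at h h3
    exact h (groupLowerSeries_eq_one_of_upperLie _ h3)
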